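/- Let $0\le T_0<T$ and let $(\mathbf u,p)$ be a smooth solution of the incompressible Euler equations $\partial_t\mathbf u+(\mathbf u\cdot\nabla)\mathbf u=-\nabla p$, $\nabla\cdot\mathbf u=0$ on $\mathbb R^3\times[0,T)$. Let $\omega=\nabla\times\mathbf u$ and $\Omega(t)=\|\omega(\cdot,t)\|_{L^\infty(\mathbb R^3)}$. Where $\omega\ne0$ put $\xi=\omega/|\omega|$, $\kappa=|\xi\cdot\nabla\xi|$, $\tau=\nabla\cdot\xi$, and where moreover $\kappa\ne0$ put $\xi^\perp=(\xi\cdot\nabla\xi)/\kappa$ (set $\xi^\perp=0$ where $\kappa=0$). For $t\in[T_0,T)$ let $L^t=\{\mathbf x(s,t):0\le s\le L(t)\}$, $L(t)>0$, be vortex line segments, i.e. $\omega\neq0$ on $L^t$ and $\partial_s\mathbf x=\xi(\mathbf x,t)$ ($s$ is the arclength), which come from the same vortex line: there are an interval $I$ and a curve $\mathbf y(\beta,t)$, $\beta\in I$, $t\in[T_0,T)$, such that $\mathbf y(\cdot,T_0)$ is a vortex line at time $T_0$ parameterized by its arclength $\beta$, $\partial_t\mathbf y=\mathbf u(\mathbf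 y,t)$, and there are differentiable functions $\beta_1\le\beta_2$ of $t$ with $[\beta_1(t),\beta_2(t)]\subset I$ such that $\mathbf x(s(\beta,t),t)=\mathbf y(\beta,t)$ for $\beta_1(t)\le\beta\le\beta_2(t)$, with $s(\cdot,t)$ continuous and nondecreasing from $s(\beta_1(t),t)=0$ to $s(\beta_2(t),t)=L(t)$. Assume that the length $L(t)$ is non-increasing in $t$. Put $$\Omega_L(t)=\max_{L^t}|\omega|,\quad V(t)=\max_{L^t}|\mathbf u\cdot\xi|,\quad U(t)=\sup_{L^t}|\mathbf u\cdot\xi^\perp|,\quad Q(t)=\frac1{L(t)}\int_0^{L(t)}|\omega(\mathbf x(s,t),t)|\,ds .$$ Assume that, for some $0<c_0\le1$ and for all $t\in[T_0,T)$, $\Omega_L(t)\ge c_0\,\Omega(t)$ and $|\omega(\mathbf x(L(t),t),t)|=\Omega_L(t)$, and that there are constants $C_0>0$, $C_l>0$ such that for all $t\in[T_0,T)$ $$\int_0^{L(t)}|\kappa(\mathbf x(s,t),t)|\,ds\le C_0,\qquad \int_0^{L(t)}|\tau(\mathbf x(s,t),t)|\,ds\le C_0,\qquad \left|\frac{d\mathbf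 x(0,t)}{dt}\cdot\xi(\mathbf x(0,t),t)\right|\le C_l\,V(t).$$ Then, with $C_1=e^{C_0}$, $C_U=C_0(2C_1-1)$ and $C_V=2C_0C_1+(C_1-1)(C_l+1)+2C_1$, for every $t\in[T_0,T)$ the function $(C_VV+C_UU)/L$ is integrable on $[T_0,t]$ and $$\Omega(t)\le\frac{Q(T_0)}{c_0}\exp\left(C_0+\int_{T_0}^{t}\frac{C_VV(t')+C_UU(t')}{L(t')}\,dt'\right).$$ -/

import Mathlib

noncomputable section

namespace VortexGrowth

open Set MeasureTheory

/-- Physical space `ℝ³` with its Euclidean norm and Lebesgue measure. -/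
abbrev E3 : Type := EuclideanSpace ℝ (Fin 3)

/-- The partial derivative `∂ᵢ vⱼ` of a vector field at the point `a`. -/
def partialD (v : E3 → E3) (i j : Fin 3) (a : E3) : ℝ :=
  (fderiv ℝ v a (EuclideanSpace.single i (1 : ℝ))) j

/-- The curl `∇ × v`. -/
def curl (v : E3 → E3) (a : E3) : E3 :=
  !₂[partialD v 1 2 a - partialD v 2 1 a,
     partialD v 2 0 a - partialD v 0 2 a,
     partialD v 0 1 a - partialD v 1 0 a]

/-- The divergence `∇ · v`. -/
def divg (v : E3 → E3) (a : E3) : ℝ := ∑ i : Fin 3, partialD v i i a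

/-- `(u, p)` is a smooth solution of the incompressible Euler equations
`∂ₜ u + (u · ∇) u = -∇ p`, `∇ · u = 0` on `ℝ³ × [0, T)`.
The time derivative at `t = 0` is the one-sided one. -/
structure IsEulerSolution (T : ℝ) (u : ℝ → E3 → E3) (p : ℝ → E3 → ℝ) : Prop where
  smooth_u : ContDiffOn ℝ ((⊤ : ℕ∞) : WithTop ℕ∞)
    (fun q : ℝ × E3 => u q.1 q.2) (Ico 0 T ×ˢ univ)
  smooth_p : ContDiffOn ℝ ((⊤ : ℕ∞) : WithTop ℕ∞)
    (fun q : ℝ × E3 => p q.1 q.2) (Ico 0 T ×ˢ univ)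
  momentum : ∀ t ∈ Ico 0 T, ∀ a : E3,
    derivWithin (fun r => u r a) (Ico 0 T) t + fderiv ℝ (u t) a (u t a) = -gradient (p t) a
  incompressible : ∀ t ∈ Ico 0 T, ∀ a : E3, divg (u t) a = 0

/-- The vorticity direction `ξ = ω / |ω|`, where `ω = ∇ × v`; it is used only where `ω ≠ 0`. -/
def xi (v : E3 → E3) (a : E3) : E3 := ‖curl v a‖⁻¹ • curl v a

/-- The vector `(ξ · ∇) ξ`. -/
def curvVec (v : E3 → E3) (a : E3) : E3 := fderiv ℝ (xi v) a (xi v a)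

/-- The unsigned curvature `κ = |(ξ · ∇) ξ|` of the vortex lines. -/
def kappa (v : E3 → E3) (a : E3) : ℝ := ‖curvVec v a‖

/-- The unit normal `ξ^⊥ = (ξ · ∇) ξ / |(ξ · ∇) ξ|`; it is `0` where the curvature vanishes,
so that such points do not contribute to `normalSpeed` below. -/
def xiPerp (v : E3 → E3) (a : E3) : E3 := (kappa v a)⁻¹ • curvVec v a

/-- `τ = ∇ · ξ`. -/
def tau (v : E3 → E3) (a : E3) : ℝ := divg (xi v) a

/-- `c : [0, ℓ] → ℝ³` is a segment of a vortex line of the velocity field `v`,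
parameterized by arclength: the vorticity does not vanish on it and `dc/ds = ξ(c)`. -/
def IsVortexSegment (v : E3 → E3) (c : ℝ → E3) (l : ℝ) : Prop :=
  ∀ s ∈ Icc 0 l, curl v (c s) ≠ 0 ∧ HasDerivWithinAt c (xi v (c s)) (Icc 0 l) s

/-- A vortex line carried by the flow during `[T₀, T)`: at time `T₀` the curve `y(·, T₀)` is a
vortex line with arclength parameter `β` in the interval `I`, and each of its
points moves with the fluid, `∂ₜ y(β, t) = u(y(β, t), t)`. -/
structure IsTransportedVortexLine (u : ℝ → E3 → E3) (T₀ T : ℝ) (I : Set ℝ)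
    (y : ℝ → ℝ → E3) : Prop where
  interval : I.OrdConnected
  nonvanishing : ∀ β ∈ I, curl (u T₀) (y β T₀) ≠ 0
  tangent : ∀ β ∈ I, HasDerivWithinAt (fun b => y b T₀) (xi (u T₀) (y β T₀)) I β
  transported : ∀ β ∈ I, ∀ t ∈ Ico T₀ T,
    HasDerivWithinAt (fun r => y β r) (u t (y β t)) (Ico T₀ T) t

/-- A family `Lᵗ = {x(s, t) : 0 ≤ s ≤ L(t)}`, `T₀ ≤ t < T`, of vortex line segments (`s` is the
arclength) which come from the same vortex line: the latter has a coordinate `β`, its arclength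
at time `T₀`, in which `Lᵗ` is `β₁(t) ≤ β ≤ β₂(t)`, with `β₁`, `β₂` differentiable in time,
and `s = s(β, t)` is a continuous increasing change of variable from
`[β₁(t), β₂(t)]` onto `[0, L(t)]`. It is not required that the segments are carried into
each other by the flow. -/
structure IsVortexSegmentFamily (u : ℝ → E3 → E3) (T₀ T : ℝ) (x : ℝ → ℝ → E3)
    (L : ℝ → ℝ) : Prop where
  length_pos : ∀ t ∈ Ico T₀ T, 0 < L t
  segment : ∀ t ∈ Ico T₀ T, IsVortexSegment (u t) (fun s => x s t) (L t)
  same_line : ∃ (I : Set ℝ) (y : ℝ → ℝ → E3) (β₁ β₂ : ℝ → ℝ) (s : ℝ → ℝ → ℝ),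
    IsTransportedVortexLine u T₀ T I y ∧
    DifferentiableOn ℝ β₁ (Ico T₀ T) ∧ DifferentiableOn ℝ β₂ (Ico T₀ T) ∧
    ∀ t ∈ Ico T₀ T, β₁ t ≤ β₂ t ∧ Icc (β₁ t) (β₂ t) ⊆ I ∧
      ContinuousOn (fun β => s β t) (Icc (β₁ t) (β₂ t)) ∧
      MonotoneOn (fun β => s β t) (Icc (β₁ t) (β₂ t)) ∧
      s (β₁ t) t = 0 ∧ s (β₂ t) t = L t ∧
      ∀ β ∈ Icc (β₁ t) (β₂ t), x (s β t) t = y β t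

/-- `Ω(t) = ‖ω(·, t)‖_{L^∞(ℝ³)}`, with values in `[0, ∞]`. -/
def maxVorticity (u : ℝ → E3 → E3) (t : ℝ) : ENNReal := eLpNorm (curl (u t)) ⊤ volume

/-- `Ω_L(t)`, the maximum of `|ω(·, t)|` over `Lᵗ`. -/
def segMaxVorticity (u : ℝ → E3 → E3) (x : ℝ → ℝ → E3) (L : ℝ → ℝ) (t : ℝ) : ℝ :=
  sSup ((fun s => ‖curl (u t) (x s t)‖) '' Icc 0 (L t))

/-- `V(t)`, the maximum of `|u · ξ|` over `Lᵗ`. -/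
def tangentialSpeed (u : ℝ → E3 → E3) (x : ℝ → ℝ → E3) (L : ℝ → ℝ) (t : ℝ) : ℝ :=
  sSup ((fun s => |inner ℝ (u t (x s t)) (xi (u t) (x s t))|) '' Icc 0 (L t))

/-- `U(t)`, the supremum of `|u · ξ^⊥|` over `Lᵗ`. -/
def normalSpeed (u : ℝ → E3 → E3) (x : ℝ → ℝ → E3) (L : ℝ → ℝ) (t : ℝ) : ℝ :=
  sSup ((fun s => |inner ℝ (u t (x s t)) (xiPerp (u t) (x s t))|) '' Icc 0 (L t))

/-- `Q(t)`, the mean of `|ω(·, t)|` over `Lᵗ`. -/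
def meanVorticity (u : ℝ → E3 → E3) (x : ℝ → ℝ → E3) (L : ℝ → ℝ) (t : ℝ) : ℝ :=
  (1 / L t) * ∫ s in (0 : ℝ)..(L t), ‖curl (u t) (x s t)‖

/-- `C_U = C₀ (2 C₁ - 1)` with `C₁ = exp C₀`. -/
def constU (C₀ : ℝ) : ℝ := C₀ * (2 * Real.exp C₀ - 1)

/-- `C_V = 2 C₀ C₁ + (C₁ - 1) (C_l + 1) + 2 C₁` with `C₁ = exp C₀`. -/
def constV (C₀ Cl : ℝ) : ℝ :=
  2 * C₀ * Real.exp C₀ + (Real.exp C₀ - 1) * (Cl + 1) + 2 * Real.exp C₀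

/-- The rate `(C_V V(t) + C_U U(t)) / L(t)`. -/
def growthRate (C₀ Cl : ℝ) (u : ℝ → E3 → E3) (x : ℝ → ℝ → E3) (L : ℝ → ℝ) (t : ℝ) : ℝ :=
  (constV C₀ Cl * tangentialSpeed u x L t + constU C₀ * normalSpeed u x L t) / L t

end VortexGrowth

end

noncomputable section

namespace VortexGrowth

open Set MeasureTheory Filter Topology
open scoped ContDiff

/-! Write w = |ω| and v = u · ξ along a segment, α = ξ · ∇u ξ, n = u · (ξ · ∇)ξ = κ u · ξ^⊥, J = ∫ w
ds (so Q = J/L), and M = w(L) = Ω_L. The proof bounds Q'/Q by the growth rate and compares Ω with Q.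

Time. Along particle paths the vorticity equation reads Dω/Dt = (∇u)ω, so w grows at rate α. By
Cauchy's formula (`hasDerivWithinAt_coord`) the β-tangent of the transported line is ω(t)/|ω(T₀)|;
the arclength density in β is therefore `stretch`, which also grows at rate α. Leibniz' rule in the
fixed coordinate β (`exists_hasDerivAt`) gives L' = b₂ - b₁ + ∫ α ds and J' = b₂ M - b₁ w(0) + 2 ∫ α
w ds, where b₁, b₂ are the speeds of the end points relative to the fluid.

Space. Since div ω = 0, ∂ₛ w = -τ w, so ∫ |τ| ≤ C₀ yields the Harnack bound M ≤ e^{C₀} w, whence Ω_L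
≤ e^{C₀} Q. Moreover ∂ₛ v = α + n, so integrating by parts replaces ∫ α and ∫ α w by end point
values of v and integrals against n and τ, which are bounded by V, U and C₀.

Combination (`segment_rate_le`). Eliminating b₂ by the formula for L' leaves L'(M L - J) in J' L -
L' J. It is nonpositive, because L' ≤ 0 and M is the maximum of w. The foot point condition gives
|b₁| ≤ (C_l + 1) V, and everything else is at most (C_V V + C_U U) J. Integrating (log Q)' and using
c₀ Ω ≤ Ω_L finishes the proof. The rate is integrable because V and U are bounded and lower
semicontinuous on compact time intervals. -/

/-! ### Linear algebra of the velocity gradient -/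

/-- The `i`-th standard basis vector of `ℝ³`. -/
abbrev stdVec (i : Fin 3) : E3 := EuclideanSpace.single i (1 : ℝ)

theorem eq_sum_stdVec (v : E3) : v = ∑ i, v i • stdVec i := by
  ext j
  fin_cases j <;> simp [Fin.sum_univ_three]

theorem clm_apply_eq_sum (A : E3 →L[ℝ] E3) (v : E3) (j : Fin 3) :
    A v j = ∑ i, v i * A (stdVec i) j := by
  conv_lhs => rw [eq_sum_stdVec v]
  simp [Fin.sum_univ_three]

/-- The linear map sending a velocity gradient to the curl. -/
def curlMap : (E3 →L[ℝ] E3) →L[ℝ] E3 :=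
  LinearMap.toContinuousLinearMap
    { toFun := fun A => !₂[A (stdVec 1) 2 - A (stdVec 2) 1,
        A (stdVec 2) 0 - A (stdVec 0) 2, A (stdVec 0) 1 - A (stdVec 1) 0]
      map_add' := fun A B => by
        ext j; fin_cases j <;> simp <;> ring
      map_smul' := fun c A => by
        ext j; fin_cases j <;> simp <;> ring }

theorem curlMap_apply (A : E3 →L[ℝ] E3) :
    curlMap A = !₂[A (stdVec 1) 2 - A (stdVec 2) 1,
        A (stdVec 2) 0 - A (stdVec 0) 2, A (stdVec 0) 1 - A (stdVec 1) 0] := rfl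

theorem curl_eq_curlMap (v : E3 → E3) (a : E3) : curl v a = curlMap (fderiv ℝ v a) := rfl

theorem divg_eq_sum (v : E3 → E3) (a : E3) :
    divg v a = ∑ i, fderiv ℝ v a (stdVec i) i := rfl

/-- A polynomial identity in the entries of A. When A = ∇u has zero trace, it turns the quadratic
term -A² in the evolution of ∇u into the stretching term Aω. -/
theorem curlMap_comp_self (A : E3 →L[ℝ] E3) :
    curlMap (A.comp A) = (∑ i, A (stdVec i) i) • curlMap A - A (curlMap A) := by
  ext j
  have h : ∀ i k, A (A (stdVec i)) k = ∑ l, A (stdVec i) l * A (stdVec l) k :=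
    fun i k => clm_apply_eq_sum A _ k
  rw [PiLp.sub_apply, clm_apply_eq_sum A (curlMap A) j]
  fin_cases j <;> simp [curlMap_apply, h, Fin.sum_univ_three] <;> ring

theorem curlMap_eq_zero {A : E3 →L[ℝ] E3} (h : ∀ i j, A (stdVec i) j = A (stdVec j) i) :
    curlMap A = 0 := by
  ext j
  fin_cases j <;> simp [curlMap_apply] <;> rw [h] <;> simp

theorem inner_eq_sum (v w : E3) : inner ℝ v w = ∑ i, v i * w i := by
  simp [PiLp.inner_apply, mul_comm]

/-! ### Derivatives of norms and directions -/

section Norm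

variable {F : Type*} [NormedAddCommGroup F] [NormedSpace ℝ F]

theorem hasFDerivWithinAt_norm {f : F → E3} {f' : F →L[ℝ] E3} {s : Set F} {a : F}
    (hf : HasFDerivWithinAt f f' s a) (h0 : f a ≠ 0) :
    HasFDerivWithinAt (fun x => ‖f x‖) (‖f a‖⁻¹ • (innerSL ℝ (f a)).comp f') s a := by
  have h1 := hf.norm_sq
  have h2 := h1.sqrt (by simpa using h0)
  simp only [Real.sqrt_sq (norm_nonneg _)] at h2
  convert h2 using 1
  ext h
  simp
  field_simp

/-- Dividing by the norm removes the radial variation: what survives is the part of f' orthogonal to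
f, scaled by 1/|f|. -/
theorem hasFDerivAt_normalize {f : F → E3} {f' : F →L[ℝ] E3} {a : F}
    (hf : HasFDerivAt f f' a) (h0 : f a ≠ 0) :
    ∃ g : F →L[ℝ] E3, HasFDerivAt (fun x => ‖f x‖⁻¹ • f x) g a ∧
      ∀ h, g h = ‖f a‖⁻¹ • (f' h - inner ℝ (‖f a‖⁻¹ • f a) (f' h) • (‖f a‖⁻¹ • f a)) := by
  have hn : ‖f a‖ ≠ 0 := by simpa using h0
  have h1 := (hasFDerivWithinAt_norm (s := univ) hf.hasFDerivWithinAt h0).hasFDerivAt univ_mem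
  have h2 := ((hasDerivAt_inv hn).comp_hasFDerivAt a h1).smul hf
  refine ⟨_, h2, fun h => ?_⟩
  simp only [add_apply, smul_apply,
    ContinuousLinearMap.smulRight_apply, smul_sub, smul_smul, inner_smul_left]
  rw [sub_eq_add_neg]
  congr 1
  rw [← neg_smul]
  congr 1
  simp
  field_simp

theorem hasDerivWithinAt_norm {f : ℝ → E3} {f' : E3} {s : Set ℝ} {t : ℝ}
    (hf : HasDerivWithinAt f f' s t) (h0 : f t ≠ 0) :
    HasDerivWithinAt (fun x => ‖f x‖) (‖f t‖⁻¹ * inner ℝ (f t) f') s t := by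
  have := (hasFDerivWithinAt_norm hf.hasFDerivWithinAt h0).hasDerivWithinAt
  simpa using this

end Norm

/-! ### Vorticity direction, curvature and τ of a smooth field -/

theorem two_le_infty : (2 : WithTop ℕ∞) ≤ ∞ :=
  WithTop.coe_le_coe.2 (le_top : (2 : ℕ∞) ≤ ⊤)

theorem curl_contDiff {v : E3 → E3} (hv : ContDiff ℝ ∞ v) : ContDiff ℝ ∞ (curl v) := by
  have : curl v = fun a => curlMap (fderiv ℝ v a) := rfl
  rw [this]
  exact curlMap.contDiff.comp (hv.fderiv_right (m := ∞) (by simp))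

theorem fderiv_curl {v : E3 → E3} (hv : ContDiff ℝ ∞ v) (a h : E3) :
    fderiv ℝ (curl v) a h = curlMap (fderiv ℝ (fderiv ℝ v) a h) := by
  have h1 : HasFDerivAt (fderiv ℝ v) (fderiv ℝ (fderiv ℝ v) a) a :=
    ((hv.fderiv_right (m := ∞) (by simp)).differentiable (by simp) a).hasFDerivAt
  have h2 : HasFDerivAt (curl v) (curlMap.comp (fderiv ℝ (fderiv ℝ v) a)) a :=
    curlMap.hasFDerivAt.comp a h1
  rw [h2.fderiv]; rfl

theorem divg_curl {v : E3 → E3} (hv : ContDiff ℝ ∞ v) (a : E3) : divg (curl v) a = 0 := by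
  have hs : ∀ i j, fderiv ℝ (fderiv ℝ v) a (stdVec i) (stdVec j) =
      fderiv ℝ (fderiv ℝ v) a (stdVec j) (stdVec i) := fun i j =>
    (hv.contDiffAt (x := a)).isSymmSndFDerivAt (by simpa using two_le_infty) _ _
  simp only [divg_eq_sum, Fin.sum_univ_three, fderiv_curl hv, curlMap_apply]
  simp [hs 1 0, hs 2 0, hs 2 1]

/-- The derivative of the vorticity direction. -/
theorem exists_hasFDerivAt_xi {v : E3 → E3} (hv : ContDiff ℝ ∞ v) {a : E3} (h0 : curl v a ≠ 0) :
    ∃ g : E3 →L[ℝ] E3, HasFDerivAt (xi v) g a ∧ ∀ h, g h = ‖curl v a‖⁻¹ •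
      (fderiv ℝ (curl v) a h - inner ℝ (xi v a) (fderiv ℝ (curl v) a h) • xi v a) :=
  hasFDerivAt_normalize ((curl_contDiff hv).differentiable (by simp) a).hasFDerivAt h0

theorem norm_xi {v : E3 → E3} {a : E3} (h0 : curl v a ≠ 0) : ‖xi v a‖ = 1 := by
  simp [xi, norm_smul, h0]

theorem norm_xi_le (v : E3 → E3) (a : E3) : ‖xi v a‖ ≤ 1 := by
  by_cases h0 : curl v a = 0
  · simp [xi, h0]
  · exact (norm_xi h0).le

theorem curl_eq_smul_xi {v : E3 → E3} {a : E3} (h0 : curl v a ≠ 0) :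
    curl v a = ‖curl v a‖ • xi v a := by
  simp [xi, smul_smul, h0]

theorem curvVec_eq {v : E3 → E3} (hv : ContDiff ℝ ∞ v) {a : E3} (h0 : curl v a ≠ 0) :
    curvVec v a = ‖curl v a‖⁻¹ • (fderiv ℝ (curl v) a (xi v a) -
      inner ℝ (xi v a) (fderiv ℝ (curl v) a (xi v a)) • xi v a) := by
  obtain ⟨g, hg, hg'⟩ := exists_hasFDerivAt_xi hv h0
  rw [curvVec, hg.fderiv, hg']

/-- Expanding div(ω/|ω|) and using div ω = 0, only the derivative of 1/|ω| along ω remains. Hence -τ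
is the logarithmic derivative of |ω| along vortex lines. -/
theorem tau_eq {v : E3 → E3} (hv : ContDiff ℝ ∞ v) {a : E3} (h0 : curl v a ≠ 0) :
    tau v a = -(‖curl v a‖⁻¹ * inner ℝ (xi v a) (fderiv ℝ (curl v) a (xi v a))) := by
  obtain ⟨g, hg, hg'⟩ := exists_hasFDerivAt_xi hv h0
  have hd := divg_curl hv a
  rw [divg_eq_sum] at hd
  have h1 : ∑ i, inner ℝ (xi v a) (fderiv ℝ (curl v) a (stdVec i)) * xi v a i =
      inner ℝ (xi v a) (fderiv ℝ (curl v) a (xi v a)) := by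
    conv_rhs => rw [eq_sum_stdVec (xi v a), map_sum, inner_sum]
    refine Finset.sum_congr rfl fun i _ => ?_
    rw [← eq_sum_stdVec, map_smul, inner_smul_right, mul_comm]
  rw [tau, divg_eq_sum, hg.fderiv]
  simp only [hg', PiLp.smul_apply, PiLp.sub_apply, smul_eq_mul, ← Finset.mul_sum,
    Finset.sum_sub_distrib]
  rw [hd, h1]
  ring

theorem abs_inner_xiPerp_le (v : E3 → E3) (a w : E3) : |inner ℝ w (xiPerp v a)| ≤ ‖w‖ := by
  have h1 : ‖xiPerp v a‖ ≤ 1 := by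
    rw [xiPerp, norm_smul, norm_inv, kappa, norm_norm]
    exact inv_mul_le_one
  calc |inner ℝ w (xiPerp v a)| ≤ ‖w‖ * ‖xiPerp v a‖ := abs_real_inner_le_norm _ _
    _ ≤ ‖w‖ * 1 := by gcongr
    _ = ‖w‖ := mul_one _

theorem inner_curvVec_eq (v : E3 → E3) (a w : E3) :
    inner ℝ w (curvVec v a) = kappa v a * inner ℝ w (xiPerp v a) := by
  rw [xiPerp, inner_smul_right]
  by_cases h : kappa v a = 0
  · have : curvVec v a = 0 := by simpa [kappa] using h
    simp [this]
  · field_simp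

/-! ### Calculus on the space-time slab and the vorticity equation -/

section

/-- The space-time slab `[0, T) × ℝ³`. -/
def slab (T : ℝ) : Set (ℝ × E3) := Ico 0 T ×ˢ univ

theorem uniqueDiffOn_slab (T : ℝ) : UniqueDiffOn ℝ (slab T) :=
  (uniqueDiffOn_Ico 0 T).prod uniqueDiffOn_univ

/-- Symmetry of second derivatives within a set holds at points of the closure of its interior; this
covers the initial face t = 0 of the slab. -/
theorem mem_closure_interior_slab {T : ℝ} {q : ℝ × E3} (hq : q ∈ slab T) :
    q ∈ closure (interior (slab T)) := by
  have h0T : 0 < T := hq.1.1.trans_lt hq.1.2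
  rw [slab, interior_prod_eq, closure_prod_eq, interior_Ico, closure_Ioo h0T.ne]
  exact ⟨⟨hq.1.1, hq.1.2.le⟩, by simp⟩

section Spatial

variable {F : Type*} [NormedAddCommGroup F] [NormedSpace ℝ F] {f : ℝ × E3 → F} {T : ℝ}

theorem hasFDerivAt_slice {f' : ℝ × E3 →L[ℝ] F} {q : ℝ × E3}
    (hq : q ∈ slab T) (hf : HasFDerivWithinAt f f' (slab T) q) :
    HasFDerivAt (fun a => f (q.1, a)) (f'.comp (ContinuousLinearMap.inr ℝ ℝ E3)) q.2 := by
  have h1 : HasFDerivWithinAt (fun a : E3 => (q.1, a)) (ContinuousLinearMap.inr ℝ ℝ E3) univ q.2 :=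
    ((hasFDerivAt_const q.1 q.2).prodMk (hasFDerivAt_id q.2)).hasFDerivWithinAt
  have h2 : MapsTo (fun a : E3 => (q.1, a)) univ (slab T) := fun a _ => ⟨hq.1, mem_univ _⟩
  exact (HasFDerivWithinAt.comp q.2 (g := f) hf h1 h2).hasFDerivAt univ_mem

theorem fderiv_slice (hf : ContDiffOn ℝ ∞ f (slab T)) {q : ℝ × E3} (hq : q ∈ slab T) :
    fderiv ℝ (fun a => f (q.1, a)) q.2 =
      (fderivWithin ℝ f (slab T) q).comp (ContinuousLinearMap.inr ℝ ℝ E3) :=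
  (hasFDerivAt_slice hq
    (hf.differentiableOn (by simp) q hq).hasFDerivWithinAt).fderiv

theorem contDiffOn_fderiv_slice (hf : ContDiffOn ℝ ∞ f (slab T)) :
    ContDiffOn ℝ ∞ (fun q : ℝ × E3 => fderiv ℝ (fun a => f (q.1, a)) q.2) (slab T) := by
  have h1 : ContDiffOn ℝ ∞ (fderivWithin ℝ f (slab T)) (slab T) :=
    hf.fderivWithin (uniqueDiffOn_slab T) (by simp)
  exact ((h1.clm_comp contDiffOn_const).congr fun q hq => fderiv_slice hf hq)

theorem contDiff_slice (hf : ContDiffOn ℝ ∞ f (slab T)) {t : ℝ} (ht : t ∈ Ico 0 T) :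
    ContDiff ℝ ∞ (fun a => f (t, a)) := by
  rw [← contDiffOn_univ]
  exact hf.comp (contDiff_const.prodMk contDiff_id).contDiffOn fun a _ => ⟨ht, mem_univ _⟩

end Spatial

namespace IsEulerSolution

variable {T : ℝ} {u : ℝ → E3 → E3} {p : ℝ → E3 → ℝ}

theorem contDiff_u (hu : IsEulerSolution T u p) {t : ℝ} (ht : t ∈ Ico 0 T) :
    ContDiff ℝ ∞ (u t) := contDiff_slice hu.smooth_u ht

theorem contDiff_p (hu : IsEulerSolution T u p) {t : ℝ} (ht : t ∈ Ico 0 T) :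
    ContDiff ℝ ∞ (p t) := contDiff_slice hu.smooth_p ht

theorem contDiffOn_fderiv (hu : IsEulerSolution T u p) :
    ContDiffOn ℝ ∞ (fun q : ℝ × E3 => fderiv ℝ (u q.1) q.2) (slab T) :=
  contDiffOn_fderiv_slice hu.smooth_u

theorem contDiffOn_curl (hu : IsEulerSolution T u p) :
    ContDiffOn ℝ ∞ (fun q : ℝ × E3 => curl (u q.1) q.2) (slab T) :=
  curlMap.contDiff.comp_contDiffOn hu.contDiffOn_fderiv

theorem contDiffOn_fderiv_curl (hu : IsEulerSolution T u p) :
    ContDiffOn ℝ ∞ (fun q : ℝ × E3 => fderiv ℝ (curl (u q.1)) q.2) (slab T) :=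
  contDiffOn_fderiv_slice hu.contDiffOn_curl

/-- Schwarz' theorem for the pressure, carried from its Fréchet derivative to its gradient. It
removes the pressure from the vorticity equation through `curlMap_eq_zero`. -/
theorem gradient_symm (hu : IsEulerSolution T u p) {t : ℝ} (ht : t ∈ Ico 0 T) (a : E3)
    (i j : Fin 3) : fderiv ℝ (gradient (p t)) a (stdVec i) j =
      fderiv ℝ (gradient (p t)) a (stdVec j) i := by
  have hp := hu.contDiff_p ht
  have hd : HasFDerivAt (fderiv ℝ (p t)) (fderiv ℝ (fderiv ℝ (p t)) a) a :=
    ((hp.fderiv_right (m := ∞) (by simp)).differentiable (by simp) a).hasFDerivAt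
  have hg : ∀ b k, gradient (p t) b k = fderiv ℝ (p t) b (stdVec k) := by
    intro b k
    have h1 : inner ℝ (gradient (p t) b) (stdVec k) = fderiv ℝ (p t) b (stdVec k) := by
      rw [gradient, InnerProductSpace.toDual_symm_apply]
    rw [← h1]
    rw [inner_eq_sum]
    simp
  have hgr : ContDiff ℝ ∞ (gradient (p t)) :=
    (InnerProductSpace.toDual ℝ E3).symm.contDiff.comp (hp.fderiv_right (m := ∞) (by simp))
  have hgd := (hgr.differentiable (by simp) a).hasFDerivAt
  have key : ∀ k h, fderiv ℝ (gradient (p t)) a h k =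
      fderiv ℝ (fderiv ℝ (p t)) a h (stdVec k) := by
    intro k h
    have e1 : HasFDerivAt (fun b => gradient (p t) b k)
        ((EuclideanSpace.proj k).comp (fderiv ℝ (gradient (p t)) a)) a :=
      (EuclideanSpace.proj (𝕜 := ℝ) k).hasFDerivAt.comp a hgd
    have e2 : HasFDerivAt (fun b => gradient (p t) b k) _ a :=
      (hd.clm_apply (hasFDerivAt_const (stdVec k) a)).congr_of_eventuallyEq
        (Eventually.of_forall fun b => hg b k)
    have := DFunLike.congr_fun (e1.unique e2) h
    simpa using this
  rw [key, key]
  exact (hp.contDiffAt (x := a)).isSymmSndFDerivAt (by simpa using two_le_infty) _ _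

/-- Evolution of the velocity gradient along a particle trajectory. -/
theorem hasDerivWithinAt_fderiv (hu : IsEulerSolution T u p) {T₀ : ℝ} (hT₀ : 0 ≤ T₀)
    {y : ℝ → E3} {t : ℝ} (ht : t ∈ Ico T₀ T)
    (hy : HasDerivWithinAt y (u t (y t)) (Ico T₀ T) t) :
    HasDerivWithinAt (fun r => fderiv ℝ (u r) (y r))
      (-((fderiv ℝ (u t) (y t)).comp (fderiv ℝ (u t) (y t))) -
        fderiv ℝ (gradient (p t)) (y t)) (Ico T₀ T) t := by
  set U : ℝ × E3 → E3 := fun q => u q.1 q.2 with hU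
  have hUs : ContDiffOn ℝ ∞ U (slab T) := hu.smooth_u
  have ht0 : t ∈ Ico 0 T := ⟨hT₀.trans ht.1, ht.2⟩
  set q₀ : ℝ × E3 := (t, y t)
  have hq₀ : q₀ ∈ slab T := ⟨ht0, mem_univ _⟩
  set D := fderivWithin ℝ U (slab T)
  have hDs : ContDiffOn ℝ ∞ D (slab T) := hUs.fderivWithin (uniqueDiffOn_slab T) (by simp)
  have hD : ∀ q ∈ slab T, HasFDerivWithinAt U (D q) (slab T) q := fun q hq =>
    (hUs.differentiableOn (by simp) q hq).hasFDerivWithinAt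
  set D2 := fderivWithin ℝ D (slab T) q₀
  have hD2 : HasFDerivWithinAt D D2 (slab T) q₀ :=
    (hDs.differentiableOn (by simp) q₀ hq₀).hasFDerivWithinAt
  have hsymm : ∀ v w, D2 v w = D2 w v := fun v w =>
    ((hUs q₀ hq₀).isSymmSndFDerivWithinAt (by simpa using two_le_infty) (uniqueDiffOn_slab T)
      (mem_closure_interior_slab hq₀) hq₀) v w
  have hsl : ∀ q ∈ slab T, fderiv ℝ (u q.1) q.2 =
      (D q).comp (ContinuousLinearMap.inr ℝ ℝ E3) := fun q hq => fderiv_slice hUs hq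
  -- the momentum equation as a directional derivative in space-time
  have hmom : ∀ a : E3, D (t, a) (1, U (t, a)) = -gradient (p t) a := by
    intro a
    have hqa : (t, a) ∈ slab T := ⟨ht0, mem_univ _⟩
    have h1 : HasDerivWithinAt (fun r : ℝ => (r, a)) ((1 : ℝ), (0 : E3)) (Ico 0 T) t :=
      (hasDerivWithinAt_id t _).prodMk (hasDerivWithinAt_const t _ a)
    have h2 : HasDerivWithinAt (fun r => u r a) (D (t, a) (1, 0)) (Ico 0 T) t :=
      HasFDerivWithinAt.comp_hasDerivWithinAt t (hl := hD _ hqa) h1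
        fun r (hr : r ∈ Ico 0 T) => show (r, a) ∈ slab T from ⟨hr, mem_univ _⟩
    have h3 := hu.momentum t ht0 a
    rw [h2.derivWithin (uniqueDiffOn_Ico 0 T t ht0), hsl (t, a) hqa] at h3
    rw [← h3]
    simp only [ContinuousLinearMap.comp_apply, ContinuousLinearMap.inr_apply, ← map_add]
    simp [hU]
  have hgr : ContDiff ℝ ∞ (gradient (p t)) :=
    (InnerProductSpace.toDual ℝ E3).symm.contDiff.comp
      ((hu.contDiff_p ht0).fderiv_right (m := ∞) (by simp))
  have hgd := (hgr.differentiable (by simp) (y t)).hasFDerivAt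
  -- Differentiate the momentum equation in the spatial direction v. After swapping arguments by
  -- `hsymm`, the second-order term becomes the derivative of ∇u along the space-time direction (1,
  -- u) of the trajectory.
  have hdiff : ∀ v : E3, D2 (0, v) (1, U q₀) + D q₀ (0, D q₀ (0, v)) =
      -fderiv ℝ (gradient (p t)) (y t) v := by
    intro v
    have e1 : HasFDerivAt (fun a => D (t, a)) (D2.comp (ContinuousLinearMap.inr ℝ ℝ E3)) (y t) :=
      hasFDerivAt_slice (q := q₀) hq₀ hD2
    have e2 : HasFDerivAt (fun a => U (t, a))
        ((D q₀).comp (ContinuousLinearMap.inr ℝ ℝ E3)) (y t) :=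
      hasFDerivAt_slice (q := q₀) hq₀ (hD q₀ hq₀)
    have e3 := e1.clm_apply ((hasFDerivAt_const (1 : ℝ) (y t)).prodMk e2)
    have e4 : HasFDerivAt (fun a => D (t, a) (1, U (t, a))) _ (y t) :=
      hgd.neg.congr_of_eventuallyEq (Eventually.of_forall hmom)
    have := DFunLike.congr_fun (e3.unique e4) v
    simpa [add_comm, q₀] using this
  have hcurve : HasDerivWithinAt (fun r => (r, y r)) ((1 : ℝ), u t (y t)) (Ico T₀ T) t :=
    (hasDerivWithinAt_id t _).prodMk hy
  have hmaps : MapsTo (fun r => (r, y r)) (Ico T₀ T) (slab T) := fun r hr =>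
    ⟨⟨hT₀.trans hr.1, hr.2⟩, mem_univ _⟩
  have hN : HasDerivWithinAt (fun r => D (r, y r)) (D2 (1, u t (y t))) (Ico T₀ T) t :=
    HasFDerivWithinAt.comp_hasDerivWithinAt t (hl := hD2) hcurve hmaps
  have hN' := hN.clm_comp (hasDerivWithinAt_const t _ (ContinuousLinearMap.inr ℝ ℝ E3))
  refine (hN'.congr (fun r hr => hsl (r, y r) (hmaps hr)) (hsl q₀ hq₀)).congr_deriv ?_
  ext1 v
  have := hdiff v
  rw [hsymm] at this
  have h1 := eq_sub_of_add_eq this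
  rw [hsl q₀ hq₀, sub_eq_add_neg, add_comm, ← sub_eq_add_neg] at *
  simpa [U, q₀, sub_eq_add_neg, add_comm] using h1

/-- The vorticity equation along a particle trajectory. -/
theorem hasDerivWithinAt_curl (hu : IsEulerSolution T u p) {T₀ : ℝ} (hT₀ : 0 ≤ T₀)
    {y : ℝ → E3} {t : ℝ} (ht : t ∈ Ico T₀ T)
    (hy : HasDerivWithinAt y (u t (y t)) (Ico T₀ T) t) :
    HasDerivWithinAt (fun r => curl (u r) (y r))
      (fderiv ℝ (u t) (y t) (curl (u t) (y t))) (Ico T₀ T) t := by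
  have ht0 : t ∈ Ico 0 T := ⟨hT₀.trans ht.1, ht.2⟩
  have h1 := curlMap.hasFDerivAt.comp_hasDerivWithinAt t (hu.hasDerivWithinAt_fderiv hT₀ ht hy)
  refine h1.congr_deriv ?_
  have h2 := hu.incompressible t ht0 (y t)
  rw [divg_eq_sum] at h2
  rw [map_sub, map_neg, curlMap_comp_self, h2, curlMap_eq_zero (hu.gradient_symm ht0 _),
    curl_eq_curlMap]
  simp

end IsEulerSolution

end


/-! ### Flow of a vortex line: dependence on the starting point and Cauchy's formula -/

section

variable {T : ℝ} {u : ℝ → E3 → E3} {p : ℝ → E3 → ℝ}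

/-- Uniform first and second order bounds for the velocity near a particle trajectory. -/
theorem IsEulerSolution.exists_bound_near (hu : IsEulerSolution T u p) {T₀ t₁ : ℝ} (hT₀ : 0 ≤ T₀)
    (ht₁ : t₁ < T) {y : ℝ → E3} (hy : ContinuousOn y (Icc T₀ t₁)) :
    ∃ K > 0, ∀ t ∈ Icc T₀ t₁, ‖fderiv ℝ (u t) (y t)‖ ≤ K ∧ ∀ z, ‖z - y t‖ ≤ 1 →
      ‖u t z - u t (y t)‖ ≤ K * ‖z - y t‖ ∧
      ‖u t z - u t (y t) - fderiv ℝ (u t) (y t) (z - y t)‖ ≤ K * ‖z - y t‖ ^ 2 := by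
  -- The tube of radius 1 about the trajectory is parameterized by time and offset, hence by a
  -- compact box.
  have hcpt : IsCompact (Icc T₀ t₁ ×ˢ Metric.closedBall (0 : E3) 1) :=
    isCompact_Icc.prod (isCompact_closedBall 0 1)
  have hmap : ContinuousOn (fun q : ℝ × E3 => (q.1, y q.1 + q.2))
      (Icc T₀ t₁ ×ˢ Metric.closedBall (0 : E3) 1) :=
    continuousOn_fst.prodMk ((hy.comp continuousOn_fst fun q hq => hq.1).add continuousOn_snd)
  have hmaps : MapsTo (fun q : ℝ × E3 => (q.1, y q.1 + q.2))
      (Icc T₀ t₁ ×ˢ Metric.closedBall (0 : E3) 1) (slab T) := fun q hq =>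
    ⟨⟨hT₀.trans hq.1.1, hq.1.2.trans_lt ht₁⟩, mem_univ _⟩
  obtain ⟨K₁, hK₁⟩ := hcpt.exists_bound_of_continuousOn
    (hu.contDiffOn_fderiv.continuousOn.comp hmap hmaps)
  obtain ⟨K₂, hK₂⟩ := hcpt.exists_bound_of_continuousOn
    ((contDiffOn_fderiv_slice hu.contDiffOn_fderiv).continuousOn.comp hmap hmaps)
  refine ⟨max (max K₁ K₂) 1, by positivity, fun t ht => ?_⟩
  have ht0 : t ∈ Ico 0 T := ⟨hT₀.trans ht.1, ht.2.trans_lt ht₁⟩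
  have hsm := hu.contDiff_u ht0
  have hsm' : ContDiff ℝ ∞ (fderiv ℝ (u t)) := hsm.fderiv_right (by simp)
  have hB₁ : ∀ w ∈ Metric.closedBall (y t) 1, ‖fderiv ℝ (u t) w‖ ≤ max (max K₁ K₂) 1 := by
    intro w hw
    have := hK₁ (t, w - y t) ⟨ht, by simpa [dist_eq_norm] using hw⟩
    simp only [Function.comp_apply, add_sub_cancel] at this
    exact this.trans ((le_max_left _ _).trans (le_max_left _ _))
  have hB₂ : ∀ w ∈ Metric.closedBall (y t) 1,
      ‖fderiv ℝ (fderiv ℝ (u t)) w‖ ≤ max (max K₁ K₂) 1 := by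
    intro w hw
    have := hK₂ (t, w - y t) ⟨ht, by simpa [dist_eq_norm] using hw⟩
    simp only [Function.comp_apply, add_sub_cancel] at this
    exact this.trans ((le_max_right _ _).trans (le_max_left _ _))
  have hy0 : y t ∈ Metric.closedBall (y t) 1 := Metric.mem_closedBall_self zero_le_one
  refine ⟨hB₁ _ hy0, fun z hz => ?_⟩
  have hz' : z ∈ Metric.closedBall (y t) 1 := by simpa [dist_eq_norm] using hz
  refine ⟨(convex_closedBall _ _).norm_image_sub_le_of_norm_fderiv_le
    (fun w _ => hsm.differentiable (by simp) w) hB₁ hy0 hz', ?_⟩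
  -- On the ball of radius |z - y| the gradient differs from its value at the centre by at most K |z
  -- - y|; the mean value inequality supplies the second factor.
  rw [pow_two, ← mul_assoc]
  refine (convex_closedBall (y t) ‖z - y t‖).norm_image_sub_le_of_norm_fderiv_le'
    (fun w _ => hsm.differentiable (by simp) w) (fun w hw => ?_)
    (Metric.mem_closedBall_self (norm_nonneg _)) (by simp [dist_eq_norm])
  rw [Metric.mem_closedBall, dist_eq_norm] at hw
  refine ((convex_closedBall (y t) 1).norm_image_sub_le_of_norm_fderiv_le
    (fun w _ => hsm'.differentiable (by simp) w) hB₂ hy0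
    (by simpa [dist_eq_norm] using hw.trans hz)).trans ?_
  gcongr

theorem HasDerivWithinAt.Ici_of_Ico {f : ℝ → E3} {f' : E3} {a b t : ℝ} (ht : t ∈ Ico a b)
    (h : HasDerivWithinAt f f' (Ico a b) t) : HasDerivWithinAt f f' (Ici t) t :=
  h.mono_of_mem_nhdsWithin <| mem_of_superset (Ico_mem_nhdsGE ht.2) (Ico_subset_Ico_left ht.1)

/-- Particle trajectories are Lipschitz in the starting point. -/
theorem trajectory_dist_le {T₀ t₁ K : ℝ} (hT : t₁ < T) (hK : 0 < K) {y z : ℝ → E3}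
    (hy : ∀ t ∈ Ico T₀ T, HasDerivWithinAt y (u t (y t)) (Ico T₀ T) t)
    (hz : ∀ t ∈ Ico T₀ T, HasDerivWithinAt z (u t (z t)) (Ico T₀ T) t)
    (hlip : ∀ t ∈ Icc T₀ t₁, ∀ w, ‖w - y t‖ ≤ 1 → ‖u t w - u t (y t)‖ ≤ K * ‖w - y t‖)
    (h0 : ‖z T₀ - y T₀‖ ≤ Real.exp (-((K + 1) * (t₁ - T₀)))) {t : ℝ} (ht : t ∈ Icc T₀ t₁) :
    ‖z t - y t‖ ≤ 1 ∧ ‖z t - y t‖ ≤ Real.exp (K * (t₁ - T₀)) * ‖z T₀ - y T₀‖ := by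
  have hsub : Icc T₀ t₁ ⊆ Ico T₀ T := fun r hr => ⟨hr.1, hr.2.trans_lt hT⟩
  have hd : ∀ r ∈ Ico T₀ T, HasDerivWithinAt (fun r => z r - y r) (u r (z r) - u r (y r))
      (Ico T₀ T) r := fun r hr => (hz r hr).sub (hy r hr)
  have hc : ContinuousOn (fun r => z r - y r) (Icc T₀ t₁) := fun r hr =>
    ((hd r (hsub hr)).continuousWithinAt).mono hsub
  have hd' : ∀ r ∈ Ico T₀ t₁, HasDerivWithinAt (fun r => z r - y r) (u r (z r) - u r (y r))
      (Ici r) r := fun r hr =>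
    HasDerivWithinAt.Ici_of_Ico (hsub (Ico_subset_Icc_self hr)) (hd r (hsub (Ico_subset_Icc_self hr)))
  -- The Lipschitz bound is available only within distance 1. This barrier equals 1 at t₁ and the
  -- permitted initial distance at T₀; its rate K + 1 exceeds K, so the distance cannot cross it.
  -- Grönwall then applies on the whole interval.
  set B : ℝ → ℝ := fun r => Real.exp ((K + 1) * (r - t₁)) with hB
  have hB1 : ∀ r ∈ Icc T₀ t₁, B r ≤ 1 := fun r hr =>
    Real.exp_le_one_iff.2 (mul_nonpos_of_nonneg_of_nonpos (by positivity) (by linarith [hr.2]))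
  have hBd : ∀ r, HasDerivAt B ((K + 1) * B r) r := fun r => by
    have := (((hasDerivAt_id r).sub_const t₁).const_mul (K + 1)).exp
    simpa [hB, mul_comm] using this
  have hle1 : ∀ r ∈ Icc T₀ t₁, ‖z r - y r‖ ≤ 1 := by
    intro r hr
    refine (image_norm_le_of_norm_deriv_right_lt_deriv_boundary' hc hd' (B := B)
      (B' := fun r => (K + 1) * B r) ?_ (fun r _ => (hBd r).continuousAt.continuousWithinAt)
      (fun r _ => (hBd r).hasDerivWithinAt) (fun r hr h => ?_) hr).trans (hB1 r hr)
    · convert h0 using 2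
      ring_nf
    · have hr' := Ico_subset_Icc_self hr
      have h1 := hlip r hr' (z r) (h.le.trans (hB1 r hr'))
      rw [h] at h1
      have : 0 < B r := Real.exp_pos _
      linarith
  refine ⟨hle1 t ht, ?_⟩
  have := norm_le_gronwallBound_of_norm_deriv_right_le hc hd' le_rfl (K := K) (ε := 0)
    (fun r hr => by
      simpa using hlip r (Ico_subset_Icc_self hr) (z r) (hle1 r (Ico_subset_Icc_self hr))) t ht
  rw [gronwallBound_ε0, mul_comm] at this
  refine this.trans ?_
  gcongr
  exact ht.2

section Transported

variable {T₀ : ℝ} {I : Set ℝ} {y : ℝ → ℝ → E3}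

namespace IsTransportedVortexLine

theorem continuousOn_time (hy : IsTransportedVortexLine u T₀ T I y) {β : ℝ} (hβ : β ∈ I)
    {t₁ : ℝ} (ht₁ : t₁ < T) : ContinuousOn (y β) (Icc T₀ t₁) := fun t ht =>
  (hy.transported β hβ t ⟨ht.1, ht.2.trans_lt ht₁⟩).continuousWithinAt.mono
    fun _ hr => ⟨hr.1, hr.2.trans_lt ht₁⟩

/-- Local Lipschitz dependence on the line coordinate. -/
theorem eventually_dist_le (hu : IsEulerSolution T u p) (hT₀ : 0 ≤ T₀)
    (hy : IsTransportedVortexLine u T₀ T I y) {β : ℝ} (hβ : β ∈ I) {t₁ : ℝ} (ht₁ : t₁ < T) :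
    ∃ C > 0, ∀ᶠ b in 𝓝[I] β, ∀ t ∈ Icc T₀ t₁,
      ‖y b t - y β t‖ ≤ 1 ∧ ‖y b t - y β t‖ ≤ C * ‖y b T₀ - y β T₀‖ := by
  obtain ⟨K, hK, hb⟩ := hu.exists_bound_near hT₀ ht₁ (hy.continuousOn_time hβ ht₁)
  refine ⟨Real.exp (K * (t₁ - T₀)), Real.exp_pos _, ?_⟩
  have hc : Tendsto (fun b => ‖y b T₀ - y β T₀‖) (𝓝[I] β) (𝓝 0) := by
    have := ((hy.tangent β hβ).continuousWithinAt.sub_const (y β T₀)).norm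
    simpa [ContinuousWithinAt] using this
  filter_upwards [hc.eventually_le_const (Real.exp_pos (-((K + 1) * (t₁ - T₀)))),
    self_mem_nhdsWithin] with b hb0 hbI t ht
  exact trajectory_dist_le ht₁ hK (hy.transported β hβ) (hy.transported b hbI)
    (fun r hr w hw => ((hb r hr).2 w hw).1) hb0 ht

/-- The Lipschitz estimate in β is uniform in time, so it combines with continuity of each single
trajectory. -/
theorem continuousOn_uncurry (hu : IsEulerSolution T u p) (hT₀ : 0 ≤ T₀)
    (hy : IsTransportedVortexLine u T₀ T I y) {t₁ : ℝ} (ht₁ : t₁ < T) :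
    ContinuousOn (fun q : ℝ × ℝ => y q.1 q.2) (I ×ˢ Icc T₀ t₁) := by
  rintro ⟨β, t⟩ ⟨hβ, ht⟩
  obtain ⟨C, hC, hev⟩ := eventually_dist_le hu hT₀ hy hβ ht₁
  have hf : Tendsto Prod.fst (𝓝[I ×ˢ Icc T₀ t₁] (β, t)) (𝓝[I] β) := by
    rw [nhdsWithin_prod_eq]; exact tendsto_fst
  have hs : Tendsto Prod.snd (𝓝[I ×ˢ Icc T₀ t₁] (β, t)) (𝓝[Icc T₀ t₁] t) := by
    rw [nhdsWithin_prod_eq]; exact tendsto_snd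
  have hc : Tendsto (fun b => ‖y b T₀ - y β T₀‖) (𝓝[I] β) (𝓝 0) := by
    have := ((hy.tangent β hβ).continuousWithinAt.sub_const (y β T₀)).norm
    simpa [ContinuousWithinAt] using this
  have hc2 : Tendsto (fun r => ‖y β r - y β t‖) (𝓝[Icc T₀ t₁] t) (𝓝 0) := by
    have := ((hy.continuousOn_time hβ ht₁ t ht).sub_const (y β t)).norm
    simpa [ContinuousWithinAt] using this
  have hlim := ((hc.comp hf).const_mul C).add (hc2.comp hs)
  rw [mul_zero, add_zero] at hlim
  refine tendsto_iff_norm_sub_tendsto_zero.2 (squeeze_zero' (Eventually.of_forall fun _ =>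
    norm_nonneg _) ?_ hlim)
  filter_upwards [hf.eventually hev, self_mem_nhdsWithin] with q hq hq'
  calc ‖y q.1 q.2 - y β t‖ = ‖(y q.1 q.2 - y β q.2) + (y β q.2 - y β t)‖ := by congr 1; abel
    _ ≤ _ := (norm_add_le _ _).trans (add_le_add (hq _ hq'.2).2 le_rfl)

/-- Along a trajectory ω solves a linear ODE with bounded coefficient. By backward uniqueness, a
zero at time t would force a zero at T₀. -/
theorem curl_ne_zero (hu : IsEulerSolution T u p) (hT₀ : 0 ≤ T₀)
    (hy : IsTransportedVortexLine u T₀ T I y) {β : ℝ} (hβ : β ∈ I) {t : ℝ} (ht : t ∈ Ico T₀ T) :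
    curl (u t) (y β t) ≠ 0 := by
  intro h0
  refine hy.nonvanishing β hβ ?_
  obtain ⟨K, hK, hb⟩ := hu.exists_bound_near hT₀ ht.2 (hy.continuousOn_time hβ ht.2)
  have hsub : Icc T₀ t ⊆ Ico T₀ T := fun r hr => ⟨hr.1, hr.2.trans_lt ht.2⟩
  have hd : ∀ r ∈ Ico T₀ T, _ := fun r hr =>
    hu.hasDerivWithinAt_curl hT₀ hr (hy.transported β hβ r hr)
  have key := ODE_solution_unique_of_mem_Icc_left (a := T₀) (b := t) (K := K.toNNReal)
    (v := fun r => fderiv ℝ (u r) (y β r)) (s := fun _ => univ)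
    (f := fun r => curl (u r) (y β r)) (g := fun _ => 0)
    (fun r hr => ?_)
    (fun r hr => (hd r (hsub hr)).continuousWithinAt.mono hsub)
    (fun r hr => (hd r (hsub (Ioc_subset_Icc_self hr))).mono_of_mem_nhdsWithin ?_)
    (fun _ _ => mem_univ _) continuousOn_const
    (fun r _ => by simpa using hasDerivWithinAt_const r (Iic r) (0 : E3)) (fun _ _ => mem_univ _) h0
  · exact key ⟨le_rfl, ht.1⟩
  · refine ((fderiv ℝ (u r) (y β r)).lipschitz.weaken ?_).lipschitzOnWith
    rw [← NNReal.coe_le_coe, Real.coe_toNNReal _ hK.le]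
    exact (hb r (Ioc_subset_Icc_self hr)).1
  · exact mem_of_superset (Icc_mem_nhdsLE hr.1) fun q hq =>
      ⟨hq.1, hq.2.trans_lt (hr.2.trans_lt ht.2)⟩

/-- Cauchy's formula: the tangent of the transported line is the rescaled vorticity. -/
theorem hasDerivWithinAt_coord (hu : IsEulerSolution T u p) (hT₀ : 0 ≤ T₀)
    (hy : IsTransportedVortexLine u T₀ T I y) {β : ℝ} (hβ : β ∈ I) {t : ℝ} (ht : t ∈ Ico T₀ T) :
    HasDerivWithinAt (fun b => y b t) (‖curl (u T₀) (y β T₀)‖⁻¹ • curl (u t) (y β t)) I β := by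
  obtain ⟨K, hK, hb⟩ := hu.exists_bound_near hT₀ ht.2 (hy.continuousOn_time hβ ht.2)
  obtain ⟨C, hC, hev⟩ := eventually_dist_le hu hT₀ hy hβ ht.2
  have hsub : Icc T₀ t ⊆ Ico T₀ T := fun r hr => ⟨hr.1, hr.2.trans_lt ht.2⟩
  -- The candidate tangent: it solves the flow equation linearized along the trajectory and starts
  -- at the unit tangent ξ.
  set W : ℝ → E3 := fun r => ‖curl (u T₀) (y β T₀)‖⁻¹ • curl (u r) (y β r) with hW
  have hWd : ∀ r ∈ Ico T₀ T, HasDerivWithinAt W (fderiv ℝ (u r) (y β r) (W r)) (Ico T₀ T) r := by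
    intro r hr
    have := (hu.hasDerivWithinAt_curl hT₀ hr (hy.transported β hβ r hr)).const_smul
      ‖curl (u T₀) (y β T₀)‖⁻¹
    exact this.congr_deriv (by rw [hW, map_smul])
  have h0 : (fun b => y b T₀ - y β T₀ - (b - β) • W T₀) =o[𝓝[I] β] fun b => b - β :=
    hasDerivWithinAt_iff_isLittleO.1 (hy.tangent β hβ)
  have h1 : (fun b => y b T₀ - y β T₀) =O[𝓝[I] β] fun b => b - β :=
    (hy.tangent β hβ).hasFDerivWithinAt.isBigO_sub
  have h2 : (fun b => ‖y b T₀ - y β T₀‖ ^ 2) =o[𝓝[I] β] fun b => b - β := by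
    have e1 : (fun b => ‖y b T₀ - y β T₀‖ ^ 2) =O[𝓝[I] β] fun b => (b - β) ^ 2 := h1.norm_left.pow 2
    refine e1.trans_isLittleO ?_
    have e2 : Tendsto (fun b : ℝ => b - β) (𝓝[I] β) (𝓝 0) := by
      have : ContinuousWithinAt (fun b : ℝ => b - β) I β := by fun_prop
      simpa [ContinuousWithinAt] using this
    simpa [pow_two] using ((Asymptotics.isLittleO_one_iff ℝ).2 e2).mul_isBigO
      (Asymptotics.isBigO_refl (fun b : ℝ => b - β) _)
  set E := Real.exp (K * (t - T₀))
  -- The first-order remainder satisfies the linearized equation up to a forcing quadratic in the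
  -- displacement. Grönwall bounds it by its initial value, which is o(b - β), plus the square of an
  -- O(b - β).
  have hmain : (fun b => y b t - y β t - (b - β) • W t) =O[𝓝[I] β]
      fun b => ‖y b T₀ - y β T₀ - (b - β) • W T₀‖ + C ^ 2 * ‖y b T₀ - y β T₀‖ ^ 2 := by
    refine Asymptotics.IsBigO.of_bound E ?_
    filter_upwards [hev, self_mem_nhdsWithin] with b hb' hbI
    have hgd : ∀ r ∈ Ico T₀ T, HasDerivWithinAt (fun r => y b r - y β r - (b - β) • W r)
        (u r (y b r) - u r (y β r) - (b - β) • fderiv ℝ (u r) (y β r) (W r)) (Ico T₀ T) r :=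
      fun r hr => ((hy.transported b hbI r hr).sub (hy.transported β hβ r hr)).sub
        ((hWd r hr).fun_const_smul (b - β))
    have hgr := norm_le_gronwallBound_of_norm_deriv_right_le (a := T₀) (b := t) (K := K)
      (ε := K * (C * ‖y b T₀ - y β T₀‖) ^ 2)
      (fun r hr => (hgd r (hsub hr)).continuousWithinAt.mono hsub)
      (fun r hr => HasDerivWithinAt.Ici_of_Ico (hsub (Ico_subset_Icc_self hr))
        (hgd r (hsub (Ico_subset_Icc_self hr)))) le_rfl (fun r hr => ?_) t ⟨ht.1, le_rfl⟩
    · refine hgr.trans ?_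
      rw [gronwallBound_of_K_ne_0 hK.ne', Real.norm_of_nonneg (by positivity)]
      have hE : 0 < E := Real.exp_pos _
      simp only
      rw [mul_div_cancel_left₀ _ hK.ne', mul_add]
      refine add_le_add (mul_comm _ _).le ?_
      rw [mul_comm E, mul_pow]
      exact mul_le_mul_of_nonneg_left (sub_le_self _ zero_le_one) (by positivity)
    · have hr' := Ico_subset_Icc_self hr
      have e1 := ((hb r hr').2 (y b r) (hb' r hr').1).2
      have e2 : u r (y b r) - u r (y β r) - (b - β) • fderiv ℝ (u r) (y β r) (W r) =
          fderiv ℝ (u r) (y β r) (y b r - y β r - (b - β) • W r) +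
          (u r (y b r) - u r (y β r) - fderiv ℝ (u r) (y β r) (y b r - y β r)) := by
        rw [map_sub _ (y b r - y β r), map_smul _ (b - β)]; abel
      rw [e2]
      refine (norm_add_le _ _).trans (add_le_add ?_ (e1.trans ?_))
      · exact (ContinuousLinearMap.le_opNorm _ _).trans (by gcongr; exact (hb r hr').1)
      · gcongr
        exact (hb' r hr').2
  exact hasDerivWithinAt_iff_isLittleO.2
    (hmain.trans_isLittleO (h0.norm_left.add (h2.const_mul_left _)))

end IsTransportedVortexLine

end Transported

end


/-! ### Integrals with moving end points -/

section Leibniz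

theorem continuousOn_slice {E : Type*} [TopologicalSpace E] {a b t₀ t₁ : ℝ} {f : ℝ → ℝ → E}
    (hf : ContinuousOn (fun q : ℝ × ℝ => f q.1 q.2) (Icc a b ×ˢ Icc t₀ t₁))
    {t : ℝ} (ht : t ∈ Icc t₀ t₁) : ContinuousOn (fun β => f β t) (Icc a b) :=
  hf.comp (continuousOn_id.prodMk continuousOn_const) fun _ hβ => ⟨hβ, ht⟩

theorem intervalIntegrable_slice {E : Type*} [NormedAddCommGroup E] {a b t₀ t₁ : ℝ} {f : ℝ → ℝ → E}
    (hf : ContinuousOn (fun q : ℝ × ℝ => f q.1 q.2) (Icc a b ×ˢ Icc t₀ t₁))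
    {t : ℝ} (ht : t ∈ Icc t₀ t₁) {c d : ℝ} (hc : c ∈ Icc a b) (hd : d ∈ Icc a b) :
    IntervalIntegrable (fun β => f β t) volume c d :=
  ((continuousOn_slice hf ht).mono (ordConnected_Icc.uIcc_subset hc hd)).intervalIntegrable

variable {E : Type*} [NormedAddCommGroup E] [NormedSpace ℝ E] {a b t₀ t₁ : ℝ}

theorem continuousOn_integral_moving {f : ℝ → ℝ → E}
    (hf : ContinuousOn (fun q : ℝ × ℝ => f q.1 q.2) (Icc a b ×ˢ Icc t₀ t₁))
    {c d : ℝ → ℝ} (hc : ContinuousOn c (Icc t₀ t₁)) (hd : ContinuousOn d (Icc t₀ t₁))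
    (hcm : MapsTo c (Icc t₀ t₁) (Icc a b)) (hdm : MapsTo d (Icc t₀ t₁) (Icc a b)) :
    ContinuousOn (fun t => ∫ β in c t..d t, f β t) (Icc t₀ t₁) := by
  intro t ht
  have hab : a ≤ b := (hcm ht).1.trans (hcm ht).2
  have ht01 : t₀ ≤ t₁ := ht.1.trans ht.2
  -- Clamping both variables extends the integrand continuously to the plane without changing it on
  -- the box.
  set g : ℝ → ℝ → E := fun r β => f (projIcc a b hab β) (projIcc t₀ t₁ ht01 r)
  have hg : Continuous g.uncurry := by
    have h1 : Continuous fun q : ℝ × ℝ =>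
        ((projIcc a b hab q.2 : ℝ), (projIcc t₀ t₁ ht01 q.1 : ℝ)) :=
      (continuous_subtype_val.comp (continuous_projIcc.comp continuous_snd)).prodMk
        (continuous_subtype_val.comp (continuous_projIcc.comp continuous_fst))
    exact hf.comp_continuous h1 fun q => ⟨(projIcc a b hab q.2).2, (projIcc t₀ t₁ ht01 q.1).2⟩
  have hP := intervalIntegral.continuous_parametric_primitive_of_continuous (μ := volume)
    (a₀ := a) hg
  have key : ContinuousOn (fun t => (∫ β in a..d t, g t β) - ∫ β in a..c t, g t β)
      (Icc t₀ t₁) :=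
    (hP.comp_continuousOn (continuousOn_id.prodMk hd)).sub
      (hP.comp_continuousOn (continuousOn_id.prodMk hc))
  refine (key.congr fun r hr => ?_) t ht
  have hgr : Continuous (g r) := hg.comp (continuous_const.prodMk continuous_id)
  rw [intervalIntegral.integral_interval_sub_left (hgr.intervalIntegrable _ _)
    (hgr.intervalIntegrable _ _)]
  refine intervalIntegral.integral_congr fun β hβ => ?_
  have hβ' := ordConnected_Icc.uIcc_subset (hcm hr) (hdm hr) hβ
  simp only [g, projIcc_of_mem hab hβ', projIcc_of_mem ht01 hr]

/-- On the shrinking interval f is uniformly close to f (c t) t, so replacing it costs o(|c r - c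
t|); no differentiability of f is needed. Vector values are allowed because the velocity of the foot
point is computed this way too. -/
theorem hasDerivAt_integral_short [CompleteSpace E] {f : ℝ → ℝ → E}
    (hf : ContinuousOn (fun q : ℝ × ℝ => f q.1 q.2) (Icc a b ×ˢ Icc t₀ t₁))
    {t : ℝ} (ht : t ∈ Ioo t₀ t₁) {c : ℝ → ℝ} {c' : ℝ} (hc : HasDerivAt c c' t)
    (hcm : MapsTo c (Icc t₀ t₁) (Icc a b)) :
    HasDerivAt (fun r => ∫ β in c t..c r, f β r) (c' • f (c t) t) t := by
  have ht' := Ioo_subset_Icc_self ht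
  have h1 : (fun r => ∫ β in c t..c r, (f β r - f (c t) t)) =o[𝓝 t] fun r => c r - c t := by
    refine Asymptotics.isLittleO_iff.2 fun ε hε => ?_
    obtain ⟨δ, hδ, h⟩ := Metric.continuousWithinAt_iff.1 (hf (c t, t) ⟨hcm ht', ht'⟩) ε hε
    filter_upwards [Icc_mem_nhds ht.1 ht.2, Metric.ball_mem_nhds t hδ,
      hc.continuousAt.preimage_mem_nhds (Metric.ball_mem_nhds (c t) hδ)] with r hr hr1 hr2
    refine intervalIntegral.norm_integral_le_of_norm_le_const fun β hβ => ?_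
    have hβ' := uIoc_subset_uIcc hβ
    have hβ2 := ordConnected_Icc.uIcc_subset (hcm ht') (hcm hr) hβ'
    rw [← dist_eq_norm]
    refine (h (x := (β, r)) ⟨hβ2, hr⟩ ?_).le
    rw [Prod.dist_eq]
    refine max_lt ?_ hr1
    refine lt_of_le_of_lt ?_ hr2
    rw [Real.dist_eq, Real.dist_eq]
    exact abs_sub_left_of_mem_uIcc hβ'
  have h2 := h1.trans_isBigO hc.hasFDerivAt.isBigO_sub
  have h3 : (fun r => (c r - c t - (r - t) • c') • f (c t) t) =o[𝓝 t] fun r => r - t := by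
    have := (hasDerivAt_iff_isLittleO.1 hc).smul_isBigO
      (Asymptotics.isBigO_refl (fun _ => f (c t) t) (𝓝 t))
    refine this.trans_isBigO ?_
    simpa using (Asymptotics.isBigO_refl (fun r : ℝ => r - t) (𝓝 t)).smul
      (Asymptotics.isBigO_const_const (f (c t) t) (one_ne_zero (α := ℝ)) (𝓝 t))
  refine hasDerivAt_iff_isLittleO.2 ((h2.add h3).congr' ?_ EventuallyEq.rfl)
  filter_upwards [Icc_mem_nhds ht.1 ht.2] with r hr
  rw [intervalIntegral.integral_sub (intervalIntegrable_slice hf hr (hcm ht') (hcm hr))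
    intervalIntegrable_const, intervalIntegral.integral_const, intervalIntegral.integral_same]
  module

/-- Differentiation under the integral sign with moving endpoints. -/
theorem hasDerivAt_integral_moving {f f' : ℝ → ℝ → ℝ}
    (hf : ContinuousOn (fun q : ℝ × ℝ => f q.1 q.2) (Icc a b ×ˢ Icc t₀ t₁))
    (hf' : ContinuousOn (fun q : ℝ × ℝ => f' q.1 q.2) (Icc a b ×ˢ Icc t₀ t₁))
    (hff' : ∀ β ∈ Icc a b, ∀ t ∈ Ioo t₀ t₁, HasDerivAt (f β) (f' β t) t)
    {t : ℝ} (ht : t ∈ Ioo t₀ t₁) {c d : ℝ → ℝ} {c' d' : ℝ} (hc : HasDerivAt c c' t)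
    (hd : HasDerivAt d d' t)
    (hcm : MapsTo c (Icc t₀ t₁) (Icc a b)) (hdm : MapsTo d (Icc t₀ t₁) (Icc a b)) :
    HasDerivAt (fun r => ∫ β in c r..d r, f β r)
      (d' * f (d t) t - c' * f (c t) t + ∫ β in c t..d t, f' β t) t := by
  have ht' := Ioo_subset_Icc_self ht
  obtain ⟨K, hK⟩ := (isCompact_Icc.prod isCompact_Icc).exists_bound_of_continuousOn hf'
  have hsub := ordConnected_Icc.uIcc_subset (hcm ht') (hdm ht')
  -- Split off the integral over the frozen interval; the two short end pieces are handled by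
  -- `hasDerivAt_integral_short`.
  have h0 : HasDerivAt (fun r => ∫ β in c t..d t, f β r) (∫ β in c t..d t, f' β t) t := by
    refine (intervalIntegral.hasDerivAt_integral_of_dominated_loc_of_deriv_le
      (F := fun r β => f β r) (F' := fun r β => f' β r) (bound := fun _ => K)
      (Ioo_mem_nhds ht.1 ht.2) ?_
      (intervalIntegrable_slice hf ht' (hcm ht') (hdm ht'))
      (intervalIntegrable_slice hf' ht' (hcm ht') (hdm ht')).def'.aestronglyMeasurable
      ?_ intervalIntegrable_const ?_).2
    · filter_upwards [Icc_mem_nhds ht.1 ht.2] with r hr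
      exact (intervalIntegrable_slice hf hr (hcm ht') (hdm ht')).def'.aestronglyMeasurable
    · exact Eventually.of_forall fun β hβ r hr =>
        hK (β, r) ⟨hsub (uIoc_subset_uIcc hβ), Ioo_subset_Icc_self hr⟩
    · exact Eventually.of_forall fun β hβ r hr => hff' β (hsub (uIoc_subset_uIcc hβ)) r hr
  have h1 := (h0.add (hasDerivAt_integral_short hf ht hd hdm)).sub
    (hasDerivAt_integral_short hf ht hc hcm)
  refine (h1.congr_of_eventuallyEq ?_).congr_deriv (by simp only [smul_eq_mul]; ring)
  filter_upwards [Icc_mem_nhds ht.1 ht.2] with r hr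
  have hi : ∀ {x y : ℝ}, x ∈ Icc a b → y ∈ Icc a b →
      IntervalIntegrable (fun β => f β r) volume x y :=
    fun hx hy => intervalIntegrable_slice hf hr hx hy
  simp only [Pi.add_apply, Pi.sub_apply]
  rw [intervalIntegral.integral_add_adjacent_intervals (hi (hcm ht') (hdm ht'))
    (hi (hdm ht') (hdm hr)), eq_sub_iff_add_eq, add_comm,
    intervalIntegral.integral_add_adjacent_intervals (hi (hcm ht') (hcm hr))
    (hi (hcm hr) (hdm hr))]

end Leibniz

/-! ### Estimates along one segment at a fixed time -/

/-- If a curve parameterized by arclength is reparameterized by a continuous change of variable,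
the change of variable is differentiable. -/
theorem hasDerivWithinAt_reparam {c Y : ℝ → E3} {s : ℝ → ℝ} {J S : Set ℝ} {β w : ℝ} {e : E3}
    (he : ‖e‖ = 1) (hβ : β ∈ J) (hc : HasDerivWithinAt c e S (s β))
    (hY : HasDerivWithinAt Y (w • e) J β) (hs : ContinuousWithinAt s J β) (hm : MapsTo s J S)
    (hcs : ∀ b ∈ J, c (s b) = Y b) : HasDerivWithinAt s w J β := by
  have h1 : (fun b => c (s b) - c (s β) - (s b - s β) • e) =o[𝓝[J] β] fun b => s b - s β :=
    (hasDerivWithinAt_iff_isLittleO.1 hc).comp_tendsto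
      (tendsto_nhdsWithin_iff.2 ⟨hs, eventually_mem_nhdsWithin.mono hm⟩)
  have hY1 : (fun b => c (s b) - c (s β)) =O[𝓝[J] β] fun b => b - β :=
    hY.hasFDerivWithinAt.isBigO_sub.congr' (eventually_mem_nhdsWithin.mono fun b hb => by
      simp only [hcs b hb, hcs β hβ]) EventuallyEq.rfl
  -- The remainder of c is small relative to s b - s β, so this increment must first be bounded by b
  -- - β; the unit length of e makes that possible.
  have h2 : (fun b => s b - s β) =O[𝓝[J] β] fun b => b - β := by
    have e1 : (fun b => c (s b) - c (s β) - (s b - s β) • e) =o[𝓝[J] β]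
        fun b => (s b - s β) • e :=
      h1.trans_isBigO (Asymptotics.isBigO_of_le _ fun b => by simp [norm_smul, he])
    have e2 := e1.right_isBigO_add
    simp only [sub_add_cancel] at e2
    refine ((Asymptotics.isBigO_of_le _ fun b => ?_).trans e2).trans hY1
    simp [norm_smul, he]
  have h3 : (fun b => Y b - Y β - (b - β) • w • e) =o[𝓝[J] β] fun b => b - β :=
    hasDerivWithinAt_iff_isLittleO.1 hY
  refine hasDerivWithinAt_iff_isLittleO.2 ?_
  have h4 := h3.sub (h1.trans_isBigO h2)
  refine Asymptotics.IsLittleO.of_norm_left (h4.norm_left.congr' ?_ EventuallyEq.rfl)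
  filter_upwards [self_mem_nhdsWithin] with b hb
  have : Y b - Y β - (b - β) • w • e - (c (s b) - c (s β) - (s b - s β) • e) =
      (s b - s β - (b - β) • w) • e := by
    rw [hcs b hb, hcs β hβ]; module
  rw [this, norm_smul, he, mul_one]

/-- Comparison of the values of a positive function through its logarithmic derivative. -/
theorem le_exp_mul_of_logDeriv {l C : ℝ} {w τ : ℝ → ℝ} (hpos : ∀ σ ∈ Icc 0 l, 0 < w σ)
    (hw : ∀ σ ∈ Icc 0 l, HasDerivWithinAt w (-(τ σ * w σ)) (Icc 0 l) σ)
    (hτ : ContinuousOn τ (Icc 0 l)) (hC : ∫ σ in (0 : ℝ)..l, |τ σ| ≤ C)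
    {σ : ℝ} (hσ : σ ∈ Icc 0 l) : w l ≤ Real.exp C * w σ := by
  have hl : 0 ≤ l := hσ.1.trans hσ.2
  have hsub : Icc σ l ⊆ Icc 0 l := Icc_subset_Icc_left hσ.1
  have hlog : ∀ r ∈ Icc 0 l, HasDerivWithinAt (fun r => Real.log (w r)) (-τ r) (Icc 0 l) r :=
    fun r hr => ((hw r hr).log (hpos r hr).ne').congr_deriv (by
      have := (hpos r hr).ne'
      field_simp)
  have hneg : ContinuousOn (fun r => -τ r) (Icc 0 l) := hτ.neg
  have h1 : ∫ r in σ..l, -τ r = Real.log (w l) - Real.log (w σ) := by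
    refine intervalIntegral.integral_eq_sub_of_hasDerivAt_of_le hσ.2
      (fun r hr => (hlog r (hsub hr)).continuousWithinAt.mono hsub) (fun r hr => ?_) ?_
    · exact (hlog r (hsub (Ioo_subset_Icc_self hr))).hasDerivAt
        (Icc_mem_nhds (hσ.1.trans_lt hr.1) hr.2)
    · exact ((hneg.mono hsub).mono (uIcc_of_le hσ.2).le).intervalIntegrable
  have habs : ContinuousOn (fun r => |τ r|) (Icc 0 l) := hτ.abs
  have hint : ∀ {p q : ℝ}, p ∈ Icc 0 l → q ∈ Icc 0 l →
      IntervalIntegrable (fun r => |τ r|) volume p q := fun hp hq =>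
    (habs.mono (ordConnected_Icc.uIcc_subset hp hq)).intervalIntegrable
  have h0m : (0 : ℝ) ∈ Icc 0 l := ⟨le_rfl, hl⟩
  have hlm : l ∈ Icc 0 l := ⟨hl, le_rfl⟩
  have h2 : ∫ r in σ..l, -τ r ≤ ∫ r in σ..l, |τ r| :=
    intervalIntegral.integral_mono_on hσ.2
      ((hneg.mono (ordConnected_Icc.uIcc_subset hσ hlm)).intervalIntegrable) (hint hσ hlm)
      fun r _ => neg_le_abs _
  have h3 : ∫ r in σ..l, |τ r| ≤ ∫ r in (0 : ℝ)..l, |τ r| := by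
    rw [← intervalIntegral.integral_add_adjacent_intervals (hint h0m hσ) (hint hσ hlm)]
    exact le_add_of_nonneg_left
      (intervalIntegral.integral_nonneg hσ.1 fun r _ => abs_nonneg _)
  have h4 : Real.log (w l) ≤ C + Real.log (w σ) := by linarith
  rw [← Real.exp_log (hpos l hlm), ← Real.exp_log (hpos σ hσ), ← Real.exp_add]
  exact Real.exp_le_exp.2 h4

theorem abs_integral_le_of_abs_le {l : ℝ} (hl : 0 ≤ l) {f g : ℝ → ℝ}
    (hg : ContinuousOn g (Icc 0 l)) (h : ∀ σ ∈ Icc 0 l, |f σ| ≤ g σ) :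
    |∫ σ in (0 : ℝ)..l, f σ| ≤ ∫ σ in (0 : ℝ)..l, g σ := by
  rw [← Real.norm_eq_abs]
  refine intervalIntegral.norm_integral_le_of_norm_le hl
    (Eventually.of_forall fun σ hσ => h σ (Ioc_subset_Icc_self hσ)) ?_
  exact (hg.mono (uIcc_of_le hl).le).intervalIntegrable

/-- The growth estimate for the integral of the vorticity over a segment, in terms of
the vorticity magnitude `w`, its logarithmic derivative `-τ`, the tangential velocity `v`, the
stretching rate `α` and the normal contribution `n`, as functions of the arclength. -/
theorem segment_rate_le {l C₀ Cl V U b₁ b₂ L' : ℝ} {w τ κ v α n : ℝ → ℝ} (hl : 0 < l)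
    (hpos : ∀ σ ∈ Icc 0 l, 0 < w σ)
    (hw : ∀ σ ∈ Icc 0 l, HasDerivWithinAt w (-(τ σ * w σ)) (Icc 0 l) σ)
    (hτ : ContinuousOn τ (Icc 0 l)) (hτC : ∫ σ in (0 : ℝ)..l, |τ σ| ≤ C₀)
    (hκ : ContinuousOn κ (Icc 0 l)) (hκC : ∫ σ in (0 : ℝ)..l, |κ σ| ≤ C₀)
    (hα : ContinuousOn α (Icc 0 l)) (hn : ContinuousOn n (Icc 0 l))
    (hv : ∀ σ ∈ Icc 0 l, HasDerivWithinAt v (α σ + n σ) (Icc 0 l) σ)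
    (hV : ∀ σ ∈ Icc 0 l, |v σ| ≤ V) (hU : 0 ≤ U) (hnU : ∀ σ ∈ Icc 0 l, |n σ| ≤ |κ σ| * U)
    (hmax : ∀ σ ∈ Icc 0 l, w σ ≤ w l) (hCl : 0 ≤ Cl) (hb₁ : |v 0 + b₁| ≤ Cl * V)
    (hL' : L' = b₂ - b₁ + ∫ σ in (0 : ℝ)..l, α σ) (hL'0 : L' ≤ 0) :
    (b₂ * w l - b₁ * w 0 + 2 * ∫ σ in (0 : ℝ)..l, α σ * w σ) * l -
        L' * ∫ σ in (0 : ℝ)..l, w σ ≤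
      (constV C₀ Cl * V + constU C₀ * U) * ∫ σ in (0 : ℝ)..l, w σ := by
  have hui : uIcc 0 l = Icc 0 l := uIcc_of_le hl.le
  have hwc : ContinuousOn w (Icc 0 l) := fun σ hσ => (hw σ hσ).continuousWithinAt
  have hvc : ContinuousOn v (Icc 0 l) := fun σ hσ => (hv σ hσ).continuousWithinAt
  have hi : ∀ {f : ℝ → ℝ}, ContinuousOn f (Icc 0 l) → IntervalIntegrable f volume 0 l :=
    fun hf => (hf.mono hui.le).intervalIntegrable
  have h0m : (0 : ℝ) ∈ Icc 0 l := ⟨le_rfl, hl.le⟩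
  have hlm : l ∈ Icc 0 l := ⟨hl.le, le_rfl⟩
  set M := w l
  set J := ∫ σ in (0 : ℝ)..l, w σ
  have hM : 0 < M := hpos l hlm
  have hV0 : 0 ≤ V := (abs_nonneg _).trans (hV 0 h0m)
  have hC₀ : 0 ≤ C₀ := (intervalIntegral.integral_nonneg hl.le fun _ _ => abs_nonneg _).trans hτC
  have hC1 : 1 ≤ Real.exp C₀ := Real.one_le_exp hC₀
  have hharnack : ∀ σ ∈ Icc 0 l, M ≤ Real.exp C₀ * w σ := fun σ hσ =>
    le_exp_mul_of_logDeriv hpos hw hτ hτC hσ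
  have hJlow : M * l ≤ Real.exp C₀ * J := by
    have := intervalIntegral.integral_mono_on hl.le (hi continuousOn_const)
      (hi (hwc.const_mul (Real.exp C₀))) hharnack
    simpa [mul_comm] using this
  have hJup : J ≤ M * l := by
    have := intervalIntegral.integral_mono_on hl.le (hi hwc) (hi continuousOn_const) hmax
    simpa [mul_comm] using this
  have hJ0 : 0 ≤ J := intervalIntegral.integral_nonneg hl.le fun σ hσ => (hpos σ hσ).le
  -- the fundamental theorem of calculus
  have hFTC : (∫ σ in (0 : ℝ)..l, α σ) + ∫ σ in (0 : ℝ)..l, n σ = v l - v 0 := by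
    rw [← intervalIntegral.integral_add (hi hα) (hi hn)]
    exact intervalIntegral.integral_eq_sub_of_hasDerivAt_of_le hl.le hvc
      (fun σ hσ => (hv σ (Ioo_subset_Icc_self hσ)).hasDerivAt (Icc_mem_nhds hσ.1 hσ.2))
      (hi (hα.add hn))
  have hαw : ContinuousOn (fun σ => α σ * w σ) (Icc 0 l) := hα.mul hwc
  have hnw : ContinuousOn (fun σ => n σ * w σ) (Icc 0 l) := hn.mul hwc
  have hsum : ContinuousOn (fun σ => α σ * w σ + n σ * w σ) (Icc 0 l) := hαw.add hnw
  have hvτw : ContinuousOn (fun σ => v σ * (τ σ * w σ)) (Icc 0 l) := hvc.mul (hτ.mul hwc)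
  -- Integration by parts for v w, with w' = -τ w.
  have hparts : (∫ σ in (0 : ℝ)..l, α σ * w σ) + (∫ σ in (0 : ℝ)..l, n σ * w σ) =
      v l * M - v 0 * w 0 + ∫ σ in (0 : ℝ)..l, v σ * (τ σ * w σ) := by
    rw [← intervalIntegral.integral_add (hi hαw) (hi hnw),
      ← sub_eq_iff_eq_add, ← intervalIntegral.integral_sub
        (hi hsum) (hi hvτw)]
    refine intervalIntegral.integral_eq_sub_of_hasDerivAt_of_le hl.le (f := fun σ => v σ * w σ)
      (hvc.mul hwc) (fun σ hσ => ?_) (hi (hsum.sub hvτw))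
    refine (((hv σ (Ioo_subset_Icc_self hσ)).mul (hw σ (Ioo_subset_Icc_self hσ))).hasDerivAt
      (Icc_mem_nhds hσ.1 hσ.2)).congr_deriv ?_
    ring
  have hB : |∫ σ in (0 : ℝ)..l, v σ * (τ σ * w σ)| ≤ V * M * C₀ := by
    refine (abs_integral_le_of_abs_le (g := fun σ => V * M * |τ σ|) hl.le (hτ.abs.const_mul _)
      fun σ hσ => ?_).trans ?_
    · rw [abs_mul, abs_mul, abs_of_pos (hpos σ hσ), mul_assoc V, mul_comm M]
      exact mul_le_mul (hV σ hσ) (mul_le_mul_of_nonneg_left (hmax σ hσ) (abs_nonneg _))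
        (mul_nonneg (abs_nonneg _) (hpos σ hσ).le) hV0
    · rw [intervalIntegral.integral_const_mul]
      exact mul_le_mul_of_nonneg_left hτC (by positivity)
  -- The normal terms from ∫ α and 2 ∫ α w are kept together: 0 < w ≤ M gives |M - 2w| ≤ M, at the
  -- cost of only one factor C₀.
  have hN : |∫ σ in (0 : ℝ)..l, n σ * (M - 2 * w σ)| ≤ U * M * C₀ := by
    refine (abs_integral_le_of_abs_le (g := fun σ => U * M * |κ σ|) hl.le (hκ.abs.const_mul _)
      fun σ hσ => ?_).trans ?_
    · have h1 : |M - 2 * w σ| ≤ M :=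
        abs_le.2 ⟨by linarith [hmax σ hσ], by linarith [hpos σ hσ]⟩
      calc |n σ * (M - 2 * w σ)| = |n σ| * |M - 2 * w σ| := abs_mul _ _
        _ ≤ (|κ σ| * U) * M := mul_le_mul (hnU σ hσ) h1 (abs_nonneg _) (by positivity)
        _ = U * M * |κ σ| := by ring
    · rw [intervalIntegral.integral_const_mul]
      exact mul_le_mul_of_nonneg_left hκC (by positivity)
  have hNsplit : ∫ σ in (0 : ℝ)..l, n σ * (M - 2 * w σ) =
      M * (∫ σ in (0 : ℝ)..l, n σ) - 2 * ∫ σ in (0 : ℝ)..l, n σ * w σ := by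
    rw [← intervalIntegral.integral_const_mul, ← intervalIntegral.integral_const_mul,
      ← intervalIntegral.integral_sub (hi (hn.const_mul M)) (hi (hnw.const_mul 2))]
    exact intervalIntegral.integral_congr fun σ _ => by ring
  set A := ∫ σ in (0 : ℝ)..l, α σ
  set P := ∫ σ in (0 : ℝ)..l, α σ * w σ
  set N := ∫ σ in (0 : ℝ)..l, n σ
  set N₂ := ∫ σ in (0 : ℝ)..l, n σ * w σ
  set B := ∫ σ in (0 : ℝ)..l, v σ * (τ σ * w σ)
  rw [hNsplit] at hN
  have hw0 := hpos 0 h0m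
  have hw0M := hmax 0 h0m
  have hA : A = v l - v 0 - N := by linarith
  have hP : P = v l * M - v 0 * w 0 + B - N₂ := by linarith
  -- The speed of the far end point has no bound of its own; it is traded for L', whose sign is
  -- known.
  have hb₂ : b₂ = L' + b₁ - A := by linarith
  have hv0 := hV 0 h0m
  have hb1V : |b₁| ≤ (Cl + 1) * V := by
    have : b₁ = (v 0 + b₁) - v 0 := by ring
    rw [this]
    exact (abs_sub _ _).trans (by linarith)
  have e1 : b₁ * (M - w 0) ≤ (Cl + 1) * V * (M - w 0) :=
    mul_le_mul_of_nonneg_right ((le_abs_self _).trans hb1V) (by linarith)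
  have e2 : v l * M ≤ V * M := mul_le_mul_of_nonneg_right ((le_abs_self _).trans (hV l hlm)) hM.le
  have e3 : v 0 * (M - 2 * w 0) ≤ V * M := by
    refine (le_abs_self _).trans ?_
    rw [abs_mul]
    exact mul_le_mul hv0 (abs_le.2 ⟨by linarith, by linarith⟩) (abs_nonneg _) hV0
  -- The difference M - w 0 is at most (1 - e^{-C₀}) M; this factor absorbs the e^{C₀} lost in
  -- passing from M l to J.
  have e4 : l * (M - w 0) ≤ (Real.exp C₀ - 1) * J := by
    have h0 := hharnack 0 h0m
    have : Real.exp C₀ * (l * (M - w 0)) ≤ Real.exp C₀ * ((Real.exp C₀ - 1) * J) := by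
      calc Real.exp C₀ * (l * (M - w 0)) = l * (Real.exp C₀ * M - Real.exp C₀ * w 0) := by ring
        _ ≤ l * (Real.exp C₀ * M - M) := by gcongr
        _ = (Real.exp C₀ - 1) * (M * l) := by ring
        _ ≤ (Real.exp C₀ - 1) * (Real.exp C₀ * J) :=
          mul_le_mul_of_nonneg_left hJlow (by linarith)
        _ = _ := by ring
    exact le_of_mul_le_mul_left this (Real.exp_pos _)
  have hD : b₂ * M - b₁ * w 0 + 2 * P = L' * M + (b₁ * (M - w 0) + v l * M +
      v 0 * (M - 2 * w 0) + (M * N - 2 * N₂) + 2 * B) := by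
    rw [hb₂, hP, hA]; ring
  have hrest : b₁ * (M - w 0) + v l * M + v 0 * (M - 2 * w 0) + (M * N - 2 * N₂) + 2 * B ≤
      (Cl + 1) * V * (M - w 0) + (2 * V + U * C₀ + 2 * V * C₀) * M := by
    have := le_abs_self (M * N - 2 * N₂)
    have := le_abs_self B
    linarith
  -- The argument gives C₀ e^{C₀} as the coefficient of U, which is at most `constU` because e^{C₀}
  -- ≥ 1.
  have hUC : U * C₀ * (Real.exp C₀ * J) ≤ U * C₀ * ((2 * Real.exp C₀ - 1) * J) :=
    mul_le_mul_of_nonneg_left (mul_le_mul_of_nonneg_right (by linarith) hJ0) (by positivity)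
  calc (b₂ * M - b₁ * w 0 + 2 * P) * l - L' * J
      = L' * (M * l - J) + l * (b₁ * (M - w 0) + v l * M +
        v 0 * (M - 2 * w 0) + (M * N - 2 * N₂) + 2 * B) := by rw [hD]; ring
    _ ≤ 0 + l * ((Cl + 1) * V * (M - w 0) + (2 * V + U * C₀ + 2 * V * C₀) * M) :=
        add_le_add (mul_nonpos_of_nonpos_of_nonneg hL'0 (by linarith))
          (mul_le_mul_of_nonneg_left hrest hl.le)
    _ = (Cl + 1) * V * (l * (M - w 0)) + (2 * V + U * C₀ + 2 * V * C₀) * (M * l) := by ring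
    _ ≤ (Cl + 1) * V * ((Real.exp C₀ - 1) * J) +
        (2 * V + U * C₀ + 2 * V * C₀) * (Real.exp C₀ * J) := by gcongr
    _ ≤ (constV C₀ Cl * V + constU C₀ * U) * J := by
        unfold constV constU; linarith

/-! ### The line coordinate and continuity of the geometric quantities -/

section

/-- The coordinate `β` on a family of vortex line segments coming from one transported line. -/
structure IsLineCoordinate (u : ℝ → E3 → E3) (T₀ T : ℝ) (x : ℝ → ℝ → E3) (L : ℝ → ℝ)
    (I : Set ℝ) (y : ℝ → ℝ → E3) (β₁ β₂ : ℝ → ℝ) (s : ℝ → ℝ → ℝ) : Prop where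
  line : IsTransportedVortexLine u T₀ T I y
  diff₁ : DifferentiableOn ℝ β₁ (Ico T₀ T)
  diff₂ : DifferentiableOn ℝ β₂ (Ico T₀ T)
  le : ∀ t ∈ Ico T₀ T, β₁ t ≤ β₂ t
  subset : ∀ t ∈ Ico T₀ T, Icc (β₁ t) (β₂ t) ⊆ I
  cont : ∀ t ∈ Ico T₀ T, ContinuousOn (fun β => s β t) (Icc (β₁ t) (β₂ t))
  mono : ∀ t ∈ Ico T₀ T, MonotoneOn (fun β => s β t) (Icc (β₁ t) (β₂ t))
  left : ∀ t ∈ Ico T₀ T, s (β₁ t) t = 0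
  right : ∀ t ∈ Ico T₀ T, s (β₂ t) t = L t
  eq : ∀ t ∈ Ico T₀ T, ∀ β ∈ Icc (β₁ t) (β₂ t), x (s β t) t = y β t

variable {T T₀ : ℝ} {u : ℝ → E3 → E3} {p : ℝ → E3 → ℝ} {x : ℝ → ℝ → E3} {L : ℝ → ℝ}
  {I : Set ℝ} {y : ℝ → ℝ → E3} {β₁ β₂ : ℝ → ℝ} {s : ℝ → ℝ → ℝ}

theorem IsVortexSegmentFamily.exists_coordinate (hx : IsVortexSegmentFamily u T₀ T x L) :
    ∃ I y β₁ β₂ s, IsLineCoordinate u T₀ T x L I y β₁ β₂ s := by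
  obtain ⟨I, y, β₁, β₂, s, h1, h2, h3, h4⟩ := hx.same_line
  exact ⟨I, y, β₁, β₂, s, h1, h2, h3, fun t ht => (h4 t ht).1, fun t ht => (h4 t ht).2.1,
    fun t ht => (h4 t ht).2.2.1, fun t ht => (h4 t ht).2.2.2.1, fun t ht => (h4 t ht).2.2.2.2.1,
    fun t ht => (h4 t ht).2.2.2.2.2.1, fun t ht => (h4 t ht).2.2.2.2.2.2⟩

/-- The density `|ω(y(β, t), t)| / |ω(y(β, T₀), T₀)|` of arclength in the line coordinate. -/
def stretch (u : ℝ → E3 → E3) (T₀ : ℝ) (y : ℝ → ℝ → E3) (β t : ℝ) : ℝ :=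
  ‖curl (u T₀) (y β T₀)‖⁻¹ * ‖curl (u t) (y β t)‖

namespace IsLineCoordinate

theorem mapsTo (hc : IsLineCoordinate u T₀ T x L I y β₁ β₂ s) {t : ℝ} (ht : t ∈ Ico T₀ T) :
    MapsTo (fun β => s β t) (Icc (β₁ t) (β₂ t)) (Icc 0 (L t)) := fun _ hβ =>
  ⟨(hc.left t ht).symm.le.trans (hc.mono t ht ⟨le_rfl, hc.le t ht⟩ hβ hβ.1),
    (hc.mono t ht hβ ⟨hc.le t ht, le_rfl⟩ hβ.2).trans (hc.right t ht).le⟩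

theorem image_eq (hc : IsLineCoordinate u T₀ T x L I y β₁ β₂ s) {t : ℝ} (ht : t ∈ Ico T₀ T) :
    (fun β => s β t) '' Icc (β₁ t) (β₂ t) = Icc 0 (L t) := by
  refine (hc.mapsTo ht).image_subset.antisymm ?_
  have := intermediate_value_Icc (hc.le t ht) (hc.cont t ht)
  rwa [hc.left t ht, hc.right t ht] at this

/-- Lets suprema over the segment be taken over an interval of β with continuously moving ends, on a
line whose points depend continuously on time. -/
theorem image_comp_eq (hc : IsLineCoordinate u T₀ T x L I y β₁ β₂ s) {t : ℝ} (ht : t ∈ Ico T₀ T)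
    (g : E3 → ℝ) :
    (fun σ => g (x σ t)) '' Icc 0 (L t) = (fun β => g (y β t)) '' Icc (β₁ t) (β₂ t) := by
  rw [← hc.image_eq ht, image_image]
  exact image_congr fun β hβ => by rw [hc.eq t ht β hβ]

/-- Cauchy's formula makes the β-tangent of the line `stretch` times the unit vector ξ, and
`hasDerivWithinAt_reparam` transfers this factor to s, which is only assumed continuous and
monotone. -/
theorem hasDerivWithinAt_arclength (hu : IsEulerSolution T u p) (hT₀ : 0 ≤ T₀)
    (hx : IsVortexSegmentFamily u T₀ T x L) (hc : IsLineCoordinate u T₀ T x L I y β₁ β₂ s)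
    {t : ℝ} (ht : t ∈ Ico T₀ T) {β : ℝ} (hβ : β ∈ Icc (β₁ t) (β₂ t)) :
    HasDerivWithinAt (fun β => s β t) (stretch u T₀ y β t) (Icc (β₁ t) (β₂ t)) β := by
  have hβI := hc.subset t ht hβ
  have hne := hc.line.curl_ne_zero hu hT₀ hβI ht
  have hseg := (hx.segment t ht (s β t) (hc.mapsTo ht hβ)).2
  simp only [hc.eq t ht β hβ] at hseg
  refine hasDerivWithinAt_reparam (norm_xi hne) hβ hseg ?_ (hc.cont t ht β hβ) (hc.mapsTo ht)
    (hc.eq t ht)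
  refine ((hc.line.hasDerivWithinAt_coord hu hT₀ hβI ht).mono (hc.subset t ht)).congr_deriv ?_
  rw [stretch, mul_smul, ← curl_eq_smul_xi hne]

end IsLineCoordinate

section Joint

/-- A continuous field on the slab is jointly continuous along the transported line. -/
theorem IsTransportedVortexLine.continuousOn_comp (hu : IsEulerSolution T u p) (hT₀ : 0 ≤ T₀)
    (hy : IsTransportedVortexLine u T₀ T I y) {t₁ : ℝ} (ht₁ : t₁ < T)
    {F : Type*} [TopologicalSpace F] {f : ℝ × E3 → F} (hf : ContinuousOn f (slab T)) :
    ContinuousOn (fun q : ℝ × ℝ => f (q.2, y q.1 q.2)) (I ×ˢ Icc T₀ t₁) :=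
  hf.comp (continuousOn_snd.prodMk (hy.continuousOn_uncurry hu hT₀ ht₁))
    fun _ hq => ⟨⟨hT₀.trans hq.2.1, hq.2.2.trans_lt ht₁⟩, mem_univ _⟩

theorem IsTransportedVortexLine.continuousOn_initial (hu : IsEulerSolution T u p) (hT₀ : 0 ≤ T₀)
    (hT : T₀ < T) (hy : IsTransportedVortexLine u T₀ T I y) :
    ContinuousOn (fun β => ‖curl (u T₀) (y β T₀)‖⁻¹) I := by
  have h1 : ContinuousOn (fun β => y β T₀) I := fun β hβ => (hy.tangent β hβ).continuousWithinAt
  have h2 := (curl_contDiff (hu.contDiff_u ⟨hT₀, hT⟩)).continuous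
  exact (h2.comp_continuousOn h1).norm.inv₀ fun β hβ => norm_ne_zero_iff.2 (hy.nonvanishing β hβ)

end Joint

/-- The stretching rate `ξ · ∇u · ξ`. -/
def stretchRate (v : E3 → E3) (a : E3) : ℝ := inner ℝ (xi v a) (fderiv ℝ v a (xi v a))

section Continuity

variable {X : Type*} [TopologicalSpace X] {S : Set X} {v : X → E3 → E3} {a : X → E3}

theorem continuousOn_xi (hω : ContinuousOn (fun q => curl (v q) (a q)) S)
    (h0 : ∀ q ∈ S, curl (v q) (a q) ≠ 0) : ContinuousOn (fun q => xi (v q) (a q)) S :=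
  (hω.norm.inv₀ fun q hq => norm_ne_zero_iff.2 (h0 q hq)).smul hω

/-- By `curvVec_eq` the vector is an expression in ω and ∇ω alone, so no joint regularity of ∇ξ has
to be established. -/
theorem continuousOn_curvVec (hv : ∀ q ∈ S, ContDiff ℝ ∞ (v q))
    (hω : ContinuousOn (fun q => curl (v q) (a q)) S)
    (hA : ContinuousOn (fun q => fderiv ℝ (curl (v q)) (a q)) S)
    (h0 : ∀ q ∈ S, curl (v q) (a q) ≠ 0) : ContinuousOn (fun q => curvVec (v q) (a q)) S := by
  have h1 := continuousOn_xi hω h0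
  have h2 : ContinuousOn (fun q => fderiv ℝ (curl (v q)) (a q) (xi (v q) (a q))) S :=
    hA.clm_apply h1
  have h3 : ContinuousOn (fun q => ‖curl (v q) (a q)‖⁻¹) S :=
    hω.norm.inv₀ fun q hq => norm_ne_zero_iff.2 (h0 q hq)
  have h4 : ContinuousOn (fun q => (inner ℝ (xi (v q) (a q))
      (fderiv ℝ (curl (v q)) (a q) (xi (v q) (a q))) : ℝ)) S := h1.inner h2
  exact (h3.smul (h2.sub (h4.smul h1))).congr fun q hq => curvVec_eq (hv q hq) (h0 q hq)

theorem continuousOn_tau (hv : ∀ q ∈ S, ContDiff ℝ ∞ (v q))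
    (hω : ContinuousOn (fun q => curl (v q) (a q)) S)
    (hA : ContinuousOn (fun q => fderiv ℝ (curl (v q)) (a q)) S)
    (h0 : ∀ q ∈ S, curl (v q) (a q) ≠ 0) : ContinuousOn (fun q => tau (v q) (a q)) S := by
  have h1 := continuousOn_xi hω h0
  have h2 : ContinuousOn (fun q => fderiv ℝ (curl (v q)) (a q) (xi (v q) (a q))) S :=
    hA.clm_apply h1
  have h3 : ContinuousOn (fun q => ‖curl (v q) (a q)‖⁻¹) S :=
    hω.norm.inv₀ fun q hq => norm_ne_zero_iff.2 (h0 q hq)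
  have h4 : ContinuousOn (fun q => (inner ℝ (xi (v q) (a q))
      (fderiv ℝ (curl (v q)) (a q) (xi (v q) (a q))) : ℝ)) S := h1.inner h2
  exact (h3.mul h4).neg.congr fun q hq => tau_eq (hv q hq) (h0 q hq)

theorem continuousOn_stretchRate (hω : ContinuousOn (fun q => curl (v q) (a q)) S)
    (hA : ContinuousOn (fun q => fderiv ℝ (v q) (a q)) S)
    (h0 : ∀ q ∈ S, curl (v q) (a q) ≠ 0) : ContinuousOn (fun q => stretchRate (v q) (a q)) S :=
  (continuousOn_xi hω h0).inner (hA.clm_apply (continuousOn_xi hω h0))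

end Continuity

section FixedTime

variable {v : E3 → E3} {c : ℝ → E3} {l : ℝ}

theorem IsVortexSegment.continuousOn (hc : IsVortexSegment v c l) : ContinuousOn c (Icc 0 l) :=
  fun σ hσ => (hc σ hσ).2.continuousWithinAt

/-- Along a vortex line, the logarithmic derivative of the vorticity magnitude is `-τ`. -/
theorem IsVortexSegment.hasDerivWithinAt_norm_curl (hv : ContDiff ℝ ∞ v)
    (hc : IsVortexSegment v c l) {σ : ℝ} (hσ : σ ∈ Icc 0 l) :
    HasDerivWithinAt (fun σ => ‖curl v (c σ)‖) (-(tau v (c σ) * ‖curl v (c σ)‖)) (Icc 0 l) σ := by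
  obtain ⟨hne, hd⟩ := hc σ hσ
  have h1 := ((curl_contDiff hv).differentiable (by simp) (c σ)).hasFDerivAt.comp_hasDerivWithinAt
    σ hd
  refine (hasDerivWithinAt_norm h1 hne).congr_deriv ?_
  have hn : ‖curl v (c σ)‖ ≠ 0 := norm_ne_zero_iff.2 hne
  rw [tau_eq hv hne, xi, inner_smul_left]
  simp
  field_simp

/-- Derivative of the tangential velocity along a vortex line. -/
theorem IsVortexSegment.hasDerivWithinAt_inner_xi (hv : ContDiff ℝ ∞ v)
    (hc : IsVortexSegment v c l) {σ : ℝ} (hσ : σ ∈ Icc 0 l) :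
    HasDerivWithinAt (fun σ => inner ℝ (v (c σ)) (xi v (c σ)))
      (stretchRate v (c σ) + inner ℝ (v (c σ)) (curvVec v (c σ))) (Icc 0 l) σ := by
  obtain ⟨hne, hd⟩ := hc σ hσ
  have h1 := (hv.differentiable (by simp) (c σ)).hasFDerivAt.comp_hasDerivWithinAt σ hd
  obtain ⟨g, hg, -⟩ := exists_hasFDerivAt_xi hv hne
  have h2 := hg.differentiableAt.hasFDerivAt.comp_hasDerivWithinAt σ hd
  refine (h1.inner ℝ h2).congr_deriv ?_
  rw [stretchRate, curvVec, add_comm]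
  exact congrArg (· + _) (real_inner_comm _ _)

end FixedTime

end


/-! ### Time derivatives of the length and of the total vorticity -/

section

variable {T T₀ : ℝ} {u : ℝ → E3 → E3} {p : ℝ → E3 → ℝ} {x : ℝ → ℝ → E3} {L : ℝ → ℝ}
  {I : Set ℝ} {y : ℝ → ℝ → E3} {β₁ β₂ : ℝ → ℝ} {s : ℝ → ℝ → ℝ}

namespace IsTransportedVortexLine

theorem continuousOn_curl (hu : IsEulerSolution T u p) (hT₀ : 0 ≤ T₀)
    (hy : IsTransportedVortexLine u T₀ T I y) {t₁ : ℝ} (ht₁ : t₁ < T) :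
    ContinuousOn (fun q : ℝ × ℝ => curl (u q.2) (y q.1 q.2)) (I ×ˢ Icc T₀ t₁) :=
  hy.continuousOn_comp hu hT₀ ht₁ hu.contDiffOn_curl.continuousOn

theorem curl_ne_zero_of_mem (hu : IsEulerSolution T u p) (hT₀ : 0 ≤ T₀)
    (hy : IsTransportedVortexLine u T₀ T I y) {t₁ : ℝ} (ht₁ : t₁ < T) :
    ∀ q ∈ I ×ˢ Icc T₀ t₁, curl (u q.2) (y q.1 q.2) ≠ 0 := fun _ hq =>
  hy.curl_ne_zero hu hT₀ hq.1 ⟨hq.2.1, hq.2.2.trans_lt ht₁⟩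

theorem continuousOn_stretchRate (hu : IsEulerSolution T u p) (hT₀ : 0 ≤ T₀)
    (hy : IsTransportedVortexLine u T₀ T I y) {t₁ : ℝ} (ht₁ : t₁ < T) :
    ContinuousOn (fun q : ℝ × ℝ => stretchRate (u q.2) (y q.1 q.2)) (I ×ˢ Icc T₀ t₁) :=
  VortexGrowth.continuousOn_stretchRate (hy.continuousOn_curl hu hT₀ ht₁)
    (hy.continuousOn_comp hu hT₀ ht₁ hu.contDiffOn_fderiv.continuousOn)
    (hy.curl_ne_zero_of_mem hu hT₀ ht₁)

theorem continuousOn_stretch (hu : IsEulerSolution T u p) (hT₀ : 0 ≤ T₀) (hT : T₀ < T)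
    (hy : IsTransportedVortexLine u T₀ T I y) {t₁ : ℝ} (ht₁ : t₁ < T) :
    ContinuousOn (fun q : ℝ × ℝ => stretch u T₀ y q.1 q.2) (I ×ˢ Icc T₀ t₁) :=
  ((hy.continuousOn_initial hu hT₀ hT).comp continuousOn_fst fun _ hq => hq.1).mul
    (hy.continuousOn_curl hu hT₀ ht₁).norm

theorem hasDerivAt_norm_curl (hu : IsEulerSolution T u p) (hT₀ : 0 ≤ T₀)
    (hy : IsTransportedVortexLine u T₀ T I y) {β : ℝ} (hβ : β ∈ I) {t : ℝ} (ht : t ∈ Ioo T₀ T) :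
    HasDerivAt (fun r => ‖curl (u r) (y β r)‖)
      (stretchRate (u t) (y β t) * ‖curl (u t) (y β t)‖) t := by
  have ht' := Ioo_subset_Ico_self ht
  have hne := hy.curl_ne_zero hu hT₀ hβ ht'
  have h1 := hasDerivWithinAt_norm
    (hu.hasDerivWithinAt_curl hT₀ ht' (hy.transported β hβ t ht')) hne
  refine (h1.hasDerivAt (Ico_mem_nhds ht.1 ht.2)).congr_deriv ?_
  have hn : ‖curl (u t) (y β t)‖ ≠ 0 := norm_ne_zero_iff.2 hne
  rw [stretchRate, xi, map_smul, inner_smul_left, inner_smul_right]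
  simp
  field_simp

theorem hasDerivAt_stretch (hu : IsEulerSolution T u p) (hT₀ : 0 ≤ T₀)
    (hy : IsTransportedVortexLine u T₀ T I y) {β : ℝ} (hβ : β ∈ I) {t : ℝ} (ht : t ∈ Ioo T₀ T) :
    HasDerivAt (stretch u T₀ y β) (stretchRate (u t) (y β t) * stretch u T₀ y β t) t :=
  ((hy.hasDerivAt_norm_curl hu hT₀ hβ ht).const_mul ‖curl (u T₀) (y β T₀)‖⁻¹).congr_deriv
    (by rw [stretch]; ring)

end IsTransportedVortexLine

namespace IsLineCoordinate

/-- The minimum of β₁ and the maximum of β₂ over a compact time interval bound one β-interval valid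
for all these times, and order-connectedness keeps it inside I. -/
theorem exists_range (hc : IsLineCoordinate u T₀ T x L I y β₁ β₂ s) {t₁ : ℝ} (h01 : T₀ ≤ t₁)
    (ht₁ : t₁ < T) : ∃ a b, Icc a b ⊆ I ∧
      MapsTo β₁ (Icc T₀ t₁) (Icc a b) ∧ MapsTo β₂ (Icc T₀ t₁) (Icc a b) := by
  have hsub : Icc T₀ t₁ ⊆ Ico T₀ T := fun r hr => ⟨hr.1, hr.2.trans_lt ht₁⟩
  obtain ⟨ta, hta, ha⟩ := isCompact_Icc.exists_isMinOn (nonempty_Icc.2 h01)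
    (hc.diff₁.continuousOn.mono hsub)
  obtain ⟨tb, htb, hb⟩ := isCompact_Icc.exists_isMaxOn (nonempty_Icc.2 h01)
    (hc.diff₂.continuousOn.mono hsub)
  refine ⟨β₁ ta, β₂ tb, hc.line.interval.out
    (hc.subset ta (hsub hta) ⟨le_rfl, hc.le ta (hsub hta)⟩)
    (hc.subset tb (hsub htb) ⟨hc.le tb (hsub htb), le_rfl⟩), fun r hr => ⟨ha hr, ?_⟩,
    fun r hr => ⟨?_, hb hr⟩⟩
  · exact (hc.le r (hsub hr)).trans (hb hr)
  · exact (show β₁ ta ≤ β₁ r from ha hr).trans (hc.le r (hsub hr))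

/-- Change of variables between the arclength and the line coordinate. -/
theorem integral_eq (hu : IsEulerSolution T u p) (hT₀ : 0 ≤ T₀)
    (hx : IsVortexSegmentFamily u T₀ T x L) (hc : IsLineCoordinate u T₀ T x L I y β₁ β₂ s)
    {t : ℝ} (ht : t ∈ Ico T₀ T) {F : E3 → ℝ} (hF : ContinuousOn (fun σ => F (x σ t)) (Icc 0 (L t))) :
    ∫ σ in (0 : ℝ)..L t, F (x σ t) =
      ∫ β in β₁ t..β₂ t, F (y β t) * stretch u T₀ y β t := by
  have hui : uIcc (β₁ t) (β₂ t) = Icc (β₁ t) (β₂ t) := uIcc_of_le (hc.le t ht)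
  have hst : ContinuousOn (fun β => stretch u T₀ y β t) (Icc (β₁ t) (β₂ t)) :=
    (continuousOn_slice (f := stretch u T₀ y) (a := β₁ t) (b := β₂ t) (t₀ := T₀) (t₁ := t)
      ((hc.line.continuousOn_stretch hu hT₀ (ht.1.trans_lt ht.2) ht.2).mono
        (prod_mono_left (hc.subset t ht)))) ⟨ht.1, le_rfl⟩
  have hd : ∀ β ∈ Ioo (min (β₁ t) (β₂ t)) (max (β₁ t) (β₂ t)),
      HasDerivWithinAt (fun β => s β t) (stretch u T₀ y β t) (Ioi β) β := by
    intro β hβ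
    rw [min_eq_left (hc.le t ht), max_eq_right (hc.le t ht)] at hβ
    exact ((hc.hasDerivWithinAt_arclength hu hT₀ hx ht (Ioo_subset_Icc_self hβ)).hasDerivAt
      (Icc_mem_nhds hβ.1 hβ.2)).hasDerivWithinAt
  have hF' : ContinuousOn (fun σ => F (x σ t)) ((fun β => s β t) '' uIcc (β₁ t) (β₂ t)) := by
    rw [hui, hc.image_eq ht]; exact hF
  have hs : ContinuousOn (fun β => s β t) (uIcc (β₁ t) (β₂ t)) := by
    rw [hui]; exact hc.cont t ht
  rw [← hui] at hst
  have h1 := intervalIntegral.integral_comp_mul_deriv'' hs hd hst hF'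
  rw [hc.left t ht, hc.right t ht] at h1
  rw [← h1]
  refine intervalIntegral.integral_congr fun β hβ => ?_
  rw [hui] at hβ
  exact congrArg (fun a => F a * stretch u T₀ y β t) (hc.eq t ht β hβ)

theorem length_eq (hu : IsEulerSolution T u p) (hT₀ : 0 ≤ T₀)
    (hx : IsVortexSegmentFamily u T₀ T x L) (hc : IsLineCoordinate u T₀ T x L I y β₁ β₂ s)
    {t : ℝ} (ht : t ∈ Ico T₀ T) : L t = ∫ β in β₁ t..β₂ t, stretch u T₀ y β t := by
  have := hc.integral_eq hu hT₀ hx ht (F := fun _ => 1) continuousOn_const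
  simpa using this

theorem continuousOn_norm_curl_segment (hu : IsEulerSolution T u p) (hT₀ : 0 ≤ T₀)
    (hx : IsVortexSegmentFamily u T₀ T x L) {t : ℝ} (ht : t ∈ Ico T₀ T) :
    ContinuousOn (fun σ => ‖curl (u t) (x σ t)‖) (Icc 0 (L t)) :=
  ((curl_contDiff (hu.contDiff_u ⟨hT₀.trans ht.1, ht.2⟩)).continuous.comp_continuousOn
    (hx.segment t ht).continuousOn).norm

theorem integral_norm_curl_eq (hu : IsEulerSolution T u p) (hT₀ : 0 ≤ T₀)
    (hx : IsVortexSegmentFamily u T₀ T x L) (hc : IsLineCoordinate u T₀ T x L I y β₁ β₂ s)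
    {t : ℝ} (ht : t ∈ Ico T₀ T) : ∫ σ in (0 : ℝ)..L t, ‖curl (u t) (x σ t)‖ =
      ∫ β in β₁ t..β₂ t, ‖curl (u t) (y β t)‖ * stretch u T₀ y β t :=
  hc.integral_eq hu hT₀ hx ht (F := fun a => ‖curl (u t) a‖)
    (continuousOn_norm_curl_segment hu hT₀ hx ht)

theorem continuousOn_curl_segment (hu : IsEulerSolution T u p) (hT₀ : 0 ≤ T₀)
    (hx : IsVortexSegmentFamily u T₀ T x L) {t : ℝ} (ht : t ∈ Ico T₀ T) :
    ContinuousOn (fun σ => curl (u t) (x σ t)) (Icc 0 (L t)) :=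
  (curl_contDiff (hu.contDiff_u ⟨hT₀.trans ht.1, ht.2⟩)).continuous.comp_continuousOn
    (hx.segment t ht).continuousOn

theorem continuousOn_stretchRate_segment (hu : IsEulerSolution T u p) (hT₀ : 0 ≤ T₀)
    (hx : IsVortexSegmentFamily u T₀ T x L) {t : ℝ} (ht : t ∈ Ico T₀ T) :
    ContinuousOn (fun σ => stretchRate (u t) (x σ t)) (Icc 0 (L t)) :=
  continuousOn_stretchRate (v := fun _ => u t) (a := fun σ => x σ t)
    (continuousOn_curl_segment hu hT₀ hx ht)
    (((hu.contDiff_u ⟨hT₀.trans ht.1, ht.2⟩).continuous_fderiv (by simp)).comp_continuousOn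
    (hx.segment t ht).continuousOn) fun σ hσ => (hx.segment t ht σ hσ).1

/-- The length and the total vorticity of the segment are continuous in time. -/
theorem continuousOn_length_mass (hu : IsEulerSolution T u p) (hT₀ : 0 ≤ T₀)
    (hx : IsVortexSegmentFamily u T₀ T x L) (hc : IsLineCoordinate u T₀ T x L I y β₁ β₂ s)
    {t₁ : ℝ} (h01 : T₀ ≤ t₁) (ht₁ : t₁ < T) :
    ContinuousOn L (Icc T₀ t₁) ∧
      ContinuousOn (fun t => ∫ σ in (0 : ℝ)..L t, ‖curl (u t) (x σ t)‖) (Icc T₀ t₁) := by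
  have hsub : Icc T₀ t₁ ⊆ Ico T₀ T := fun r hr => ⟨hr.1, hr.2.trans_lt ht₁⟩
  have hT : T₀ < T := h01.trans_lt ht₁
  obtain ⟨a, b, hab, h1, h2⟩ := hc.exists_range h01 ht₁
  have hg := (hc.line.continuousOn_stretch hu hT₀ hT ht₁).mono (prod_mono_left hab)
  have hw := ((hc.line.continuousOn_curl hu hT₀ ht₁).norm).mono (prod_mono_left hab)
  have hb1 := hc.diff₁.continuousOn.mono hsub
  have hb2 := hc.diff₂.continuousOn.mono hsub
  exact ⟨(continuousOn_integral_moving (f := stretch u T₀ y) hg hb1 hb2 h1 h2).congr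
      fun t ht => hc.length_eq hu hT₀ hx (hsub ht),
    (continuousOn_integral_moving
      (f := fun β t => ‖curl (u t) (y β t)‖ * stretch u T₀ y β t) (hw.mul hg) hb1 hb2 h1 h2).congr
      fun t ht => hc.integral_norm_curl_eq hu hT₀ hx (hsub ht)⟩

/-- Time derivatives of the length and of the total vorticity of the segment, and the velocity of
its foot point, in terms of the speeds `b₁`, `b₂` of the end points relative to the fluid. -/
theorem exists_hasDerivAt (hu : IsEulerSolution T u p) (hT₀ : 0 ≤ T₀)
    (hx : IsVortexSegmentFamily u T₀ T x L) (hc : IsLineCoordinate u T₀ T x L I y β₁ β₂ s)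
    {t : ℝ} (ht : t ∈ Ioo T₀ T) :
    ∃ b₁ b₂ : ℝ,
      HasDerivAt L (b₂ - b₁ + ∫ σ in (0 : ℝ)..L t, stretchRate (u t) (x σ t)) t ∧
      HasDerivAt (fun r => ∫ σ in (0 : ℝ)..L r, ‖curl (u r) (x σ r)‖)
        (b₂ * ‖curl (u t) (x (L t) t)‖ - b₁ * ‖curl (u t) (x 0 t)‖ +
          2 * ∫ σ in (0 : ℝ)..L t, stretchRate (u t) (x σ t) * ‖curl (u t) (x σ t)‖) t ∧
      HasDerivAt (fun r => x 0 r) (u t (x 0 t) + b₁ • xi (u t) (x 0 t)) t := by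
  obtain ⟨t₁, htt₁, ht₁⟩ := exists_between ht.2
  have h01 : T₀ ≤ t₁ := (ht.1.trans htt₁).le
  have hsub : Icc T₀ t₁ ⊆ Ico T₀ T := fun r hr => ⟨hr.1, hr.2.trans_lt ht₁⟩
  have hT : T₀ < T := h01.trans_lt ht₁
  have htI : t ∈ Ioo T₀ t₁ := ⟨ht.1, htt₁⟩
  have ht' := Ioo_subset_Ico_self ht
  obtain ⟨a, b, hab, h1, h2⟩ := hc.exists_range h01 ht₁
  have hg := (hc.line.continuousOn_stretch hu hT₀ hT ht₁).mono (prod_mono_left hab)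
  have hω := (hc.line.continuousOn_curl hu hT₀ ht₁).mono (prod_mono_left hab)
  have hα := (hc.line.continuousOn_stretchRate hu hT₀ ht₁).mono (prod_mono_left hab)
  have hd1 : HasDerivAt β₁ (deriv β₁ t) t :=
    ((hc.diff₁ t ht').differentiableAt (Ico_mem_nhds ht.1 ht.2)).hasDerivAt
  have hd2 : HasDerivAt β₂ (deriv β₂ t) t :=
    ((hc.diff₂ t ht').differentiableAt (Ico_mem_nhds ht.1 ht.2)).hasDerivAt
  have hev : ∀ᶠ r in 𝓝 t, r ∈ Icc T₀ t₁ := Icc_mem_nhds htI.1 htI.2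
  have hle := hc.le t ht'
  have hx0 : ∀ r ∈ Ico T₀ T, x 0 r = y (β₁ r) r := fun r hr => by
    rw [← hc.left r hr, hc.eq r hr _ ⟨le_rfl, hc.le r hr⟩]
  have hxL : x (L t) t = y (β₂ t) t := by
    rw [← hc.right t ht', hc.eq t ht' _ ⟨hle, le_rfl⟩]
  have htT : ∀ {r}, r ∈ Ioo T₀ t₁ → r ∈ Ioo T₀ T := fun hr => ⟨hr.1, hr.2.trans ht₁⟩
  -- The speed of an end point relative to the fluid is its β-speed times the arclength density
  -- there.
  refine ⟨deriv β₁ t * stretch u T₀ y (β₁ t) t, deriv β₂ t * stretch u T₀ y (β₂ t) t, ?_, ?_, ?_⟩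
  · have := hasDerivAt_integral_moving (f := stretch u T₀ y)
      (f' := fun β t => stretchRate (u t) (y β t) * stretch u T₀ y β t) hg (hα.mul hg)
      (fun β hβ r hr => hc.line.hasDerivAt_stretch hu hT₀ (hab hβ) (htT hr)) htI hd1 hd2 h1 h2
    rw [hc.integral_eq hu hT₀ hx ht' (F := stretchRate (u t))
      (continuousOn_stretchRate_segment hu hT₀ hx ht')]
    exact this.congr_of_eventuallyEq (hev.mono fun r hr => hc.length_eq hu hT₀ hx (hsub hr))
  -- The factor 2 arises because both |ω| and the arclength density grow at the stretching rate.
  · have := hasDerivAt_integral_moving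
      (f := fun β t => ‖curl (u t) (y β t)‖ * stretch u T₀ y β t)
      (f' := fun β t => 2 * (stretchRate (u t) (y β t) * ‖curl (u t) (y β t)‖ *
        stretch u T₀ y β t)) (hω.norm.mul hg) (((hα.mul hω.norm).mul hg).const_mul 2)
      (fun β hβ r hr => ((hc.line.hasDerivAt_norm_curl hu hT₀ (hab hβ) (htT hr)).mul
        (hc.line.hasDerivAt_stretch hu hT₀ (hab hβ) (htT hr))).congr_deriv (by ring))
      htI hd1 hd2 h1 h2
    rw [hc.integral_eq hu hT₀ hx ht' (F := fun a => stretchRate (u t) a * ‖curl (u t) a‖)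
      ((continuousOn_stretchRate_segment hu hT₀ hx ht').mul
        (continuousOn_norm_curl_segment hu hT₀ hx ht')), hxL, hx0 t ht']
    refine (this.congr_of_eventuallyEq (hev.mono fun r hr =>
      hc.integral_norm_curl_eq hu hT₀ hx (hsub hr))).congr_deriv ?_
    rw [intervalIntegral.integral_const_mul]
    ring
  · set W : ℝ → ℝ → E3 := fun β r => ‖curl (u T₀) (y β T₀)‖⁻¹ • curl (u r) (y β r)
    have hW : ContinuousOn (fun q : ℝ × ℝ => W q.1 q.2) (Icc a b ×ˢ Icc T₀ t₁) :=
      (((hc.line.continuousOn_initial hu hT₀ hT).mono hab).comp continuousOn_fst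
        fun _ hq => hq.1).smul hω
    have hβ1 : β₁ t ∈ I := hc.subset t ht' ⟨le_rfl, hle⟩
    have hne := hc.line.curl_ne_zero hu hT₀ hβ1 ht'
    -- The foot point at time r is the particle that was the foot at time t, plus the integral of
    -- the tangent W from β₁ t to β₁ r. Joint differentiability of y is thus not required.
    have hd := ((hc.line.transported _ hβ1 t ht').hasDerivAt (Ico_mem_nhds ht.1 ht.2)).add
      (hasDerivAt_integral_short hW htI hd1 h1)
    refine (hd.congr_of_eventuallyEq ?_).congr_deriv ?_
    · filter_upwards [hev] with r hr
      have hr1 := h1 hr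
      have ht1 := h1 (Ioo_subset_Icc_self htI)
      have hsubI : uIcc (β₁ t) (β₁ r) ⊆ I := (ordConnected_Icc.uIcc_subset ht1 hr1).trans hab
      rw [hx0 r (hsub hr), Pi.add_apply, intervalIntegral.integral_eq_sub_of_hasDeriv_right
        (f := fun b => y b r) (f' := fun b => W b r)]
      · simp
      · exact fun c hcm => (hc.line.hasDerivWithinAt_coord hu hT₀ (hsubI hcm)
          (hsub hr)).continuousWithinAt.mono hsubI
      · intro c hcm
        have hI : I ∈ 𝓝 c := mem_of_superset (Icc_mem_nhds hcm.1 hcm.2) hsubI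
        exact ((hc.line.hasDerivWithinAt_coord hu hT₀ (mem_of_mem_nhds hI)
          (hsub hr)).hasDerivAt hI).hasDerivWithinAt
      · exact intervalIntegrable_slice hW hr ht1 hr1
    · rw [hx0 t ht', mul_smul, stretch, mul_smul, ← curl_eq_smul_xi hne]

end IsLineCoordinate

end


/-! ### Measurability and integrability of the growth rate -/

section

section Sup

variable {a b t₀ t₁ K : ℝ} {φ : ℝ → ℝ → ℝ} {c d : ℝ → ℝ}

/-- The supremum of a lower semicontinuous function over a continuously moving interval is lower
semicontinuous. -/
theorem lowerSemicontinuousOn_sSup_moving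
    (hφ : LowerSemicontinuousOn (fun q : ℝ × ℝ => φ q.1 q.2) (Icc a b ×ˢ Icc t₀ t₁))
    (hK : ∀ β ∈ Icc a b, ∀ t ∈ Icc t₀ t₁, φ β t ≤ K)
    (hc : ContinuousOn c (Icc t₀ t₁)) (hd : ContinuousOn d (Icc t₀ t₁))
    (hcm : MapsTo c (Icc t₀ t₁) (Icc a b)) (hdm : MapsTo d (Icc t₀ t₁) (Icc a b))
    (hcd : ∀ t ∈ Icc t₀ t₁, c t ≤ d t) :
    LowerSemicontinuousOn (fun t => sSup ((fun β => φ β t) '' Icc (c t) (d t))) (Icc t₀ t₁) := by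
  intro t ht A hA
  have hbdd : ∀ r ∈ Icc t₀ t₁, BddAbove ((fun β => φ β r) '' Icc (c r) (d r)) := by
    rintro r hr
    refine ⟨K, ?_⟩
    rintro _ ⟨β, hβ, rfl⟩
    exact hK β (Icc_subset_Icc (hcm hr).1 (hdm hr).2 hβ) r hr
  obtain ⟨_, ⟨β₀, hβ₀, rfl⟩, hA'⟩ := exists_lt_of_lt_csSup
    ((nonempty_Icc.2 (hcd t ht)).image _) hA
  -- A near-maximizer at time t, clamped into the moving interval: a continuous path of admissible
  -- points through β₀.
  set γ : ℝ → ℝ := fun r => max (c r) (min β₀ (d r))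
  have hγm : ∀ r ∈ Icc t₀ t₁, γ r ∈ Icc (c r) (d r) := fun r hr =>
    ⟨le_max_left _ _, max_le (hcd r hr) (min_le_right _ _)⟩
  have hγt : γ t = β₀ := by
    simp only [γ, min_eq_left hβ₀.2, max_eq_right hβ₀.1]
  have hγ : ContinuousOn γ (Icc t₀ t₁) := hc.sup (continuousOn_const.inf hd)
  have hmaps : MapsTo (fun r => (γ r, r)) (Icc t₀ t₁) (Icc a b ×ˢ Icc t₀ t₁) := fun r hr =>
    ⟨Icc_subset_Icc (hcm hr).1 (hdm hr).2 (hγm r hr), hr⟩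
  have hpair : Tendsto (fun r => (γ r, r)) (𝓝[Icc t₀ t₁] t)
      (𝓝[Icc a b ×ˢ Icc t₀ t₁] (γ t, t)) :=
    tendsto_nhdsWithin_iff.2 ⟨(hγ t ht).prodMk continuousWithinAt_id,
      eventually_mem_nhdsWithin.mono hmaps⟩
  have hev := hpair.eventually (hφ (γ t, t) (hmaps ht) A (by simpa only [hγt] using hA'))
  filter_upwards [hev, self_mem_nhdsWithin] with r hr hrm
  exact hr.trans_le (le_csSup (hbdd r hrm) ⟨γ r, hγm r hrm, rfl⟩)

theorem integrableOn_sSup_moving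
    (hφ : LowerSemicontinuousOn (fun q : ℝ × ℝ => φ q.1 q.2) (Icc a b ×ˢ Icc t₀ t₁))
    (hφ0 : ∀ β t, 0 ≤ φ β t) (hK : ∀ β ∈ Icc a b, ∀ t ∈ Icc t₀ t₁, φ β t ≤ K)
    (hc : ContinuousOn c (Icc t₀ t₁)) (hd : ContinuousOn d (Icc t₀ t₁))
    (hcm : MapsTo c (Icc t₀ t₁) (Icc a b)) (hdm : MapsTo d (Icc t₀ t₁) (Icc a b))
    (hcd : ∀ t ∈ Icc t₀ t₁, c t ≤ d t) :
    IntegrableOn (fun t => sSup ((fun β => φ β t) '' Icc (c t) (d t))) (Icc t₀ t₁) := by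
  have h1 := lowerSemicontinuousOn_sSup_moving hφ hK hc hd hcm hdm hcd
  have h2 : Measurable fun t : Icc t₀ t₁ =>
      sSup ((fun β => φ β (t : ℝ)) '' Icc (c (t : ℝ)) (d (t : ℝ))) :=
    (lowerSemicontinuous_restrict_iff.2 h1).measurable
  have h3 := aemeasurable_restrict_of_measurable_subtype (μ := volume)
    (f := fun t => sSup ((fun β => φ β t) '' Icc (c t) (d t))) measurableSet_Icc h2
  refine Integrable.of_bound h3.aestronglyMeasurable K ?_
  refine (ae_restrict_iff' measurableSet_Icc).2 (Eventually.of_forall fun t ht => ?_)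
  rw [Real.norm_of_nonneg (Real.sSup_nonneg (by rintro _ ⟨β, -, rfl⟩; exact hφ0 β t))]
  refine csSup_le ((nonempty_Icc.2 (hcd t ht)).image _) ?_
  rintro _ ⟨β, hβ, rfl⟩
  exact hK β (Icc_subset_Icc (hcm ht).1 (hdm ht).2 hβ) t ht

end Sup

variable {T T₀ : ℝ} {u : ℝ → E3 → E3} {p : ℝ → E3 → ℝ} {x : ℝ → ℝ → E3} {L : ℝ → ℝ}
  {I : Set ℝ} {y : ℝ → ℝ → E3} {β₁ β₂ : ℝ → ℝ} {s : ℝ → ℝ → ℝ}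

theorem segMaxVorticity_spec (hu : IsEulerSolution T u p) (hT₀ : 0 ≤ T₀)
    (hx : IsVortexSegmentFamily u T₀ T x L) {t : ℝ} (ht : t ∈ Ico T₀ T) {σ : ℝ}
    (hσ : σ ∈ Icc 0 (L t)) : ‖curl (u t) (x σ t)‖ ≤ segMaxVorticity u x L t :=
  le_csSup (isCompact_Icc.image_of_continuousOn
    (IsLineCoordinate.continuousOn_norm_curl_segment hu hT₀ hx ht)).bddAbove ⟨σ, hσ, rfl⟩

theorem exists_velocity_bound (hu : IsEulerSolution T u p) (hT₀ : 0 ≤ T₀)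
    (hx : IsVortexSegmentFamily u T₀ T x L) {t : ℝ} (ht : t ∈ Ico T₀ T) :
    ∃ K, ∀ σ ∈ Icc 0 (L t), ‖u t (x σ t)‖ ≤ K :=
  isCompact_Icc.exists_bound_of_continuousOn
    ((hu.contDiff_u ⟨hT₀.trans ht.1, ht.2⟩).continuous.comp_continuousOn
      (hx.segment t ht).continuousOn)

theorem abs_inner_xi_le (v : E3 → E3) (a w : E3) : |inner ℝ w (xi v a)| ≤ ‖w‖ :=
  (abs_real_inner_le_norm _ _).trans
    (mul_le_of_le_one_right (norm_nonneg _) (norm_xi_le v a))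

theorem tangentialSpeed_spec (hu : IsEulerSolution T u p) (hT₀ : 0 ≤ T₀)
    (hx : IsVortexSegmentFamily u T₀ T x L) {t : ℝ} (ht : t ∈ Ico T₀ T) {σ : ℝ}
    (hσ : σ ∈ Icc 0 (L t)) :
    |inner ℝ (u t (x σ t)) (xi (u t) (x σ t))| ≤ tangentialSpeed u x L t := by
  obtain ⟨K, hK⟩ := exists_velocity_bound hu hT₀ hx ht
  refine le_csSup ⟨K, ?_⟩ ⟨σ, hσ, rfl⟩
  rintro _ ⟨r, hr, rfl⟩
  exact (abs_inner_xi_le _ _ _).trans (hK r hr)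

theorem normalSpeed_spec (hu : IsEulerSolution T u p) (hT₀ : 0 ≤ T₀)
    (hx : IsVortexSegmentFamily u T₀ T x L) {t : ℝ} (ht : t ∈ Ico T₀ T) {σ : ℝ}
    (hσ : σ ∈ Icc 0 (L t)) :
    |inner ℝ (u t (x σ t)) (xiPerp (u t) (x σ t))| ≤ normalSpeed u x L t := by
  obtain ⟨K, hK⟩ := exists_velocity_bound hu hT₀ hx ht
  refine le_csSup ⟨K, ?_⟩ ⟨σ, hσ, rfl⟩
  rintro _ ⟨r, hr, rfl⟩
  exact (abs_inner_xiPerp_le _ _ _).trans (hK r hr)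

theorem normalSpeed_nonneg (t : ℝ) : 0 ≤ normalSpeed u x L t :=
  Real.sSup_nonneg (by rintro _ ⟨σ, -, rfl⟩; exact abs_nonneg _)

namespace IsLineCoordinate

/-- The normal may jump where κ = 0. There the convention ξ^⊥ = 0 gives this nonnegative function
its least possible value, so lower semicontinuity persists; elsewhere the function is continuous. -/
theorem lowerSemicontinuousOn_normal (hu : IsEulerSolution T u p) (hT₀ : 0 ≤ T₀)
    (hy : IsTransportedVortexLine u T₀ T I y) {t₁ : ℝ} (ht₁ : t₁ < T) :
    LowerSemicontinuousOn (fun q : ℝ × ℝ => |inner ℝ (u q.2 (y q.1 q.2))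
      (xiPerp (u q.2) (y q.1 q.2))|) (I ×ˢ Icc T₀ t₁) := by
  intro q hq
  have hv : ∀ q ∈ I ×ˢ Icc T₀ t₁, ContDiff ℝ ∞ (u q.2) := fun q hq =>
    hu.contDiff_u ⟨hT₀.trans hq.2.1, hq.2.2.trans_lt ht₁⟩
  have hcv : ContinuousOn (fun q : ℝ × ℝ => curvVec (u q.2) (y q.1 q.2)) (I ×ˢ Icc T₀ t₁) :=
    continuousOn_curvVec hv (hy.continuousOn_curl hu hT₀ ht₁)
      (hy.continuousOn_comp hu hT₀ ht₁ hu.contDiffOn_fderiv_curl.continuousOn)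
      (hy.curl_ne_zero_of_mem hu hT₀ ht₁)
  have huc : ContinuousOn (fun q : ℝ × ℝ => u q.2 (y q.1 q.2)) (I ×ˢ Icc T₀ t₁) :=
    hy.continuousOn_comp hu hT₀ ht₁ hu.smooth_u.continuousOn
  by_cases h0 : kappa (u q.2) (y q.1 q.2) = 0
  · intro A hA
    have : A < 0 := by simpa [xiPerp, h0] using hA
    exact Eventually.of_forall fun r => this.trans_le (abs_nonneg _)
  · have hk : ContinuousWithinAt (fun q : ℝ × ℝ => (kappa (u q.2) (y q.1 q.2))⁻¹)
        (I ×ˢ Icc T₀ t₁) q := (hcv q hq).norm.inv₀ h0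
    have hp : ContinuousWithinAt (fun q : ℝ × ℝ => xiPerp (u q.2) (y q.1 q.2))
        (I ×ˢ Icc T₀ t₁) q := hk.smul (hcv q hq)
    have hi : ContinuousWithinAt (fun q : ℝ × ℝ => (inner ℝ (u q.2 (y q.1 q.2))
      (xiPerp (u q.2) (y q.1 q.2)) : ℝ)) (I ×ˢ Icc T₀ t₁) q := (huc q hq).inner hp
    exact hi.abs.lowerSemicontinuousWithinAt

theorem lowerSemicontinuousOn_tangential (hu : IsEulerSolution T u p) (hT₀ : 0 ≤ T₀)
    (hy : IsTransportedVortexLine u T₀ T I y) {t₁ : ℝ} (ht₁ : t₁ < T) :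
    LowerSemicontinuousOn (fun q : ℝ × ℝ => |inner ℝ (u q.2 (y q.1 q.2))
      (xi (u q.2) (y q.1 q.2))|) (I ×ˢ Icc T₀ t₁) := by
  have hxi : ContinuousOn (fun q : ℝ × ℝ => xi (u q.2) (y q.1 q.2)) (I ×ˢ Icc T₀ t₁) :=
    continuousOn_xi (hy.continuousOn_curl hu hT₀ ht₁) (hy.curl_ne_zero_of_mem hu hT₀ ht₁)
  have huc : ContinuousOn (fun q : ℝ × ℝ => u q.2 (y q.1 q.2)) (I ×ˢ Icc T₀ t₁) :=
    hy.continuousOn_comp hu hT₀ ht₁ hu.smooth_u.continuousOn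
  have hi : ContinuousOn (fun q : ℝ × ℝ => (inner ℝ (u q.2 (y q.1 q.2))
      (xi (u q.2) (y q.1 q.2)) : ℝ)) (I ×ˢ Icc T₀ t₁) := huc.inner hxi
  exact fun q hq => (hi q hq).abs.lowerSemicontinuousWithinAt

theorem integrableOn_growthRate (hu : IsEulerSolution T u p) (hT₀ : 0 ≤ T₀)
    (hx : IsVortexSegmentFamily u T₀ T x L) (hc : IsLineCoordinate u T₀ T x L I y β₁ β₂ s)
    (C₀ Cl : ℝ) {t₁ : ℝ} (h01 : T₀ ≤ t₁) (ht₁ : t₁ < T) :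
    IntegrableOn (growthRate C₀ Cl u x L) (Icc T₀ t₁) := by
  have hsub : Icc T₀ t₁ ⊆ Ico T₀ T := fun r hr => ⟨hr.1, hr.2.trans_lt ht₁⟩
  obtain ⟨a, b, hab, h1, h2⟩ := hc.exists_range h01 ht₁
  have hb1 := hc.diff₁.continuousOn.mono hsub
  have hb2 := hc.diff₂.continuousOn.mono hsub
  have huc : ContinuousOn (fun q : ℝ × ℝ => u q.2 (y q.1 q.2)) (Icc a b ×ˢ Icc T₀ t₁) :=
    (hc.line.continuousOn_comp hu hT₀ ht₁ hu.smooth_u.continuousOn).mono (prod_mono_left hab)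
  obtain ⟨K, hK⟩ := (isCompact_Icc.prod isCompact_Icc).exists_bound_of_continuousOn huc
  have hV : IntegrableOn (tangentialSpeed u x L) (Icc T₀ t₁) :=
    (integrableOn_sSup_moving (K := K)
      (φ := fun β t => |inner ℝ (u t (y β t)) (xi (u t) (y β t))|)
      ((lowerSemicontinuousOn_tangential hu hT₀ hc.line ht₁).mono (prod_mono_left hab))
      (fun _ _ => abs_nonneg _)
      (fun β hβ t ht => (abs_inner_xi_le _ _ _).trans (hK (β, t) ⟨hβ, ht⟩))
      hb1 hb2 h1 h2 fun t ht => hc.le t (hsub ht)).congr_fun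
      (fun t ht => congrArg sSup (hc.image_comp_eq (hsub ht)
        fun a => |inner ℝ (u t a) (xi (u t) a)|).symm) measurableSet_Icc
  have hU : IntegrableOn (normalSpeed u x L) (Icc T₀ t₁) :=
    (integrableOn_sSup_moving (K := K)
      (φ := fun β t => |inner ℝ (u t (y β t)) (xiPerp (u t) (y β t))|)
      ((lowerSemicontinuousOn_normal hu hT₀ hc.line ht₁).mono (prod_mono_left hab))
      (fun _ _ => abs_nonneg _)
      (fun β hβ t ht => (abs_inner_xiPerp_le _ _ _).trans (hK (β, t) ⟨hβ, ht⟩))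
      hb1 hb2 h1 h2 fun t ht => hc.le t (hsub ht)).congr_fun
      (fun t ht => congrArg sSup (hc.image_comp_eq (hsub ht)
        fun a => |inner ℝ (u t a) (xiPerp (u t) a)|).symm) measurableSet_Icc
  have hL : ContinuousOn (fun t => (L t)⁻¹) (Icc T₀ t₁) :=
    (hc.continuousOn_length_mass hu hT₀ hx h01 ht₁).1.inv₀
      fun t ht => (hx.length_pos t (hsub ht)).ne'
  have hVU : IntegrableOn (fun t => constV C₀ Cl * tangentialSpeed u x L t +
      constU C₀ * normalSpeed u x L t) (Icc T₀ t₁) := (hV.const_mul _).add (hU.const_mul _)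
  exact hVU.mul_continuousOn hL isCompact_Icc

end IsLineCoordinate

end


/-! ### The differential inequality for the mean vorticity -/

section

variable {T T₀ : ℝ} {u : ℝ → E3 → E3} {p : ℝ → E3 → ℝ} {x : ℝ → ℝ → E3} {L : ℝ → ℝ}
  {C₀ Cl : ℝ}

/-- The integral of `|ω(·, t)|` over `Lᵗ`. -/
def segMass (u : ℝ → E3 → E3) (x : ℝ → ℝ → E3) (L : ℝ → ℝ) (t : ℝ) : ℝ :=
  ∫ σ in (0 : ℝ)..L t, ‖curl (u t) (x σ t)‖

theorem segMass_pos (hu : IsEulerSolution T u p) (hT₀ : 0 ≤ T₀)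
    (hx : IsVortexSegmentFamily u T₀ T x L) {t : ℝ} (ht : t ∈ Ico T₀ T) : 0 < segMass u x L t := by
  have hl := hx.length_pos t ht
  refine intervalIntegral.intervalIntegral_pos_of_pos_on ?_ (fun σ hσ => ?_) hl
  · exact ((IsLineCoordinate.continuousOn_norm_curl_segment hu hT₀ hx ht).mono
      (uIcc_of_le hl.le).le).intervalIntegrable
  · exact norm_pos_iff.2 (hx.segment t ht σ (Ioo_subset_Icc_self hσ)).1

theorem continuousOn_tau_segment (hu : IsEulerSolution T u p) (hT₀ : 0 ≤ T₀)
    (hx : IsVortexSegmentFamily u T₀ T x L) {t : ℝ} (ht : t ∈ Ico T₀ T) :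
    ContinuousOn (fun σ => tau (u t) (x σ t)) (Icc 0 (L t)) := by
  have hv := hu.contDiff_u ⟨hT₀.trans ht.1, ht.2⟩
  exact continuousOn_tau (v := fun _ => u t) (a := fun σ => x σ t) (fun _ _ => hv)
    (IsLineCoordinate.continuousOn_curl_segment hu hT₀ hx ht)
    (((curl_contDiff hv).continuous_fderiv (by simp)).comp_continuousOn
      (hx.segment t ht).continuousOn) fun σ hσ => (hx.segment t ht σ hσ).1

theorem continuousOn_curvVec_segment (hu : IsEulerSolution T u p) (hT₀ : 0 ≤ T₀)
    (hx : IsVortexSegmentFamily u T₀ T x L) {t : ℝ} (ht : t ∈ Ico T₀ T) :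
    ContinuousOn (fun σ => curvVec (u t) (x σ t)) (Icc 0 (L t)) := by
  have hv := hu.contDiff_u ⟨hT₀.trans ht.1, ht.2⟩
  exact continuousOn_curvVec (v := fun _ => u t) (a := fun σ => x σ t) (fun _ _ => hv)
    (IsLineCoordinate.continuousOn_curl_segment hu hT₀ hx ht)
    (((curl_contDiff hv).continuous_fderiv (by simp)).comp_continuousOn
      (hx.segment t ht).continuousOn) fun σ hσ => (hx.segment t ht σ hσ).1

/-- The maximal vorticity on the segment is controlled by the mean. -/
theorem segMaxVorticity_le (hu : IsEulerSolution T u p) (hT₀ : 0 ≤ T₀)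
    (hx : IsVortexSegmentFamily u T₀ T x L) {t : ℝ} (ht : t ∈ Ico T₀ T)
    (hend : ‖curl (u t) (x (L t) t)‖ = segMaxVorticity u x L t)
    (htau : ∫ σ in (0 : ℝ)..L t, |tau (u t) (x σ t)| ≤ C₀) :
    segMaxVorticity u x L t ≤ Real.exp C₀ * meanVorticity u x L t := by
  have hl := hx.length_pos t ht
  have hv := hu.contDiff_u ⟨hT₀.trans ht.1, ht.2⟩
  have hw := IsLineCoordinate.continuousOn_norm_curl_segment hu hT₀ hx ht
  have h1 : ∀ σ ∈ Icc 0 (L t), segMaxVorticity u x L t ≤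
      Real.exp C₀ * ‖curl (u t) (x σ t)‖ := fun σ hσ => by
    rw [← hend]
    exact le_exp_mul_of_logDeriv (w := fun σ => ‖curl (u t) (x σ t)‖)
      (fun r hr => norm_pos_iff.2 (hx.segment t ht r hr).1)
      (fun r hr => (hx.segment t ht).hasDerivWithinAt_norm_curl hv hr)
      (continuousOn_tau_segment hu hT₀ hx ht) htau hσ
  have h2 := intervalIntegral.integral_mono_on (μ := volume) hl.le intervalIntegrable_const
    ((hw.const_mul (Real.exp C₀)).mono (uIcc_of_le hl.le).le).intervalIntegrable h1
  rw [intervalIntegral.integral_const, intervalIntegral.integral_const_mul, sub_zero,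
    smul_eq_mul] at h2
  rw [meanVorticity, one_div, ← mul_assoc, mul_comm (Real.exp C₀), mul_assoc,
    ← div_eq_inv_mul, le_div_iff₀ hl, mul_comm]
  exact h2

/-- The differential inequality for the mean vorticity. -/
theorem exists_hasDerivAt_meanVorticity (hu : IsEulerSolution T u p) (hT₀ : 0 ≤ T₀)
    (hx : IsVortexSegmentFamily u T₀ T x L) (hL : AntitoneOn L (Ico T₀ T)) (hCl : 0 ≤ Cl)
    {t : ℝ} (ht : t ∈ Ioo T₀ T)
    (hend : ‖curl (u t) (x (L t) t)‖ = segMaxVorticity u x L t)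
    (hkappa : ∫ σ in (0 : ℝ)..L t, |kappa (u t) (x σ t)| ≤ C₀)
    (htau : ∫ σ in (0 : ℝ)..L t, |tau (u t) (x σ t)| ≤ C₀)
    (hfoot : ∃ x₀' : E3, HasDerivWithinAt (fun r => x 0 r) x₀' (Ico T₀ T) t ∧
      |inner ℝ x₀' (xi (u t) (x 0 t))| ≤ Cl * tangentialSpeed u x L t) :
    ∃ Q', HasDerivAt (meanVorticity u x L) Q' t ∧
      Q' ≤ growthRate C₀ Cl u x L t * meanVorticity u x L t := by
  obtain ⟨I, y, β₁, β₂, s, hc⟩ := hx.exists_coordinate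
  have ht' := Ioo_subset_Ico_self ht
  have hl := hx.length_pos t ht'
  have hnhds : Ico T₀ T ∈ 𝓝 t := Ico_mem_nhds ht.1 ht.2
  have h0m : (0 : ℝ) ∈ Icc 0 (L t) := ⟨le_rfl, hl.le⟩
  have hv := hu.contDiff_u ⟨hT₀.trans ht'.1, ht'.2⟩
  have hseg := hx.segment t ht'
  obtain ⟨b₁, b₂, hLd, hJd, hxd⟩ := hc.exists_hasDerivAt hu hT₀ hx ht
  obtain ⟨x₀', hx₀', hbound⟩ := hfoot
  -- The foot moves with velocity u + b₁ ξ and |ξ| = 1, so the hypothesis on it bounds u · ξ + b₁.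
  have hfootb : |inner ℝ (u t (x 0 t)) (xi (u t) (x 0 t)) + b₁| ≤
      Cl * tangentialSpeed u x L t := by
    rw [(hx₀'.hasDerivAt hnhds).unique hxd, inner_add_left, inner_smul_left,
      real_inner_self_eq_norm_sq, norm_xi (hseg 0 h0m).1] at hbound
    simpa using hbound
  have hL'0 : b₂ - b₁ + ∫ σ in (0 : ℝ)..L t, stretchRate (u t) (x σ t) ≤ 0 := by
    rw [← hLd.deriv, ← derivWithin_of_mem_nhds hnhds]
    exact hL.derivWithin_nonpos
  have hcv := continuousOn_curvVec_segment hu hT₀ hx ht'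
  have hux : ContinuousOn (fun σ => u t (x σ t)) (Icc 0 (L t)) :=
    hv.continuous.comp_continuousOn hseg.continuousOn
  have key := segment_rate_le (w := fun σ => ‖curl (u t) (x σ t)‖)
    (τ := fun σ => tau (u t) (x σ t)) (κ := fun σ => kappa (u t) (x σ t))
    (v := fun σ => inner ℝ (u t (x σ t)) (xi (u t) (x σ t)))
    (α := fun σ => stretchRate (u t) (x σ t))
    (n := fun σ => inner ℝ (u t (x σ t)) (curvVec (u t) (x σ t)))
    (V := tangentialSpeed u x L t) (U := normalSpeed u x L t) hl
    (fun σ hσ => norm_pos_iff.2 (hseg σ hσ).1)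
    (fun σ hσ => hseg.hasDerivWithinAt_norm_curl hv hσ)
    (continuousOn_tau_segment hu hT₀ hx ht') htau hcv.norm hkappa
    (IsLineCoordinate.continuousOn_stretchRate_segment hu hT₀ hx ht') (hux.inner hcv)
    (fun σ hσ => hseg.hasDerivWithinAt_inner_xi hv hσ)
    (fun σ hσ => tangentialSpeed_spec hu hT₀ hx ht' hσ) (normalSpeed_nonneg t)
    (fun σ hσ => by
      rw [inner_curvVec_eq, abs_mul]
      exact mul_le_mul_of_nonneg_left (normalSpeed_spec hu hT₀ hx ht' hσ) (abs_nonneg _))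
    (fun σ hσ => (segMaxVorticity_spec hu hT₀ hx ht' hσ).trans hend.ge) hCl hfootb rfl hL'0
  have hQ : meanVorticity u x L = fun r => segMass u x L r / L r := by
    funext r
    rw [meanVorticity, segMass, one_div, div_eq_inv_mul]
  rw [hQ]
  refine ⟨_, HasDerivAt.fun_div hJd hLd hl.ne', ?_⟩
  have hgr : growthRate C₀ Cl u x L t * (segMass u x L t / L t) =
      ((constV C₀ Cl * tangentialSpeed u x L t + constU C₀ * normalSpeed u x L t) *
        segMass u x L t) / L t ^ 2 := by
    rw [growthRate]; field_simp
  simp only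
  rw [hgr]
  gcongr
  rw [mul_comm (segMass u x L t)]
  exact key

/-- The mean vorticity grows at most exponentially with the integrated rate. -/
theorem meanVorticity_le (hu : IsEulerSolution T u p) (hT₀ : 0 ≤ T₀)
    (hx : IsVortexSegmentFamily u T₀ T x L) (hL : AntitoneOn L (Ico T₀ T)) (hCl : 0 ≤ Cl)
    (hend : ∀ t ∈ Ico T₀ T, ‖curl (u t) (x (L t) t)‖ = segMaxVorticity u x L t)
    (hkappa : ∀ t ∈ Ico T₀ T, ∫ σ in (0 : ℝ)..L t, |kappa (u t) (x σ t)| ≤ C₀)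
    (htau : ∀ t ∈ Ico T₀ T, ∫ σ in (0 : ℝ)..L t, |tau (u t) (x σ t)| ≤ C₀)
    (hfoot : ∀ t ∈ Ico T₀ T, ∃ x₀' : E3, HasDerivWithinAt (fun r => x 0 r) x₀' (Ico T₀ T) t ∧
      |inner ℝ x₀' (xi (u t) (x 0 t))| ≤ Cl * tangentialSpeed u x L t)
    {t : ℝ} (ht : t ∈ Ico T₀ T) :
    meanVorticity u x L t ≤
      meanVorticity u x L T₀ * Real.exp (∫ r in T₀..t, growthRate C₀ Cl u x L r) := by
  obtain ⟨I, y, β₁, β₂, s, hc⟩ := hx.exists_coordinate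
  have hsub : Icc T₀ t ⊆ Ico T₀ T := fun r hr => ⟨hr.1, hr.2.trans_lt ht.2⟩
  have hpos : ∀ r ∈ Ico T₀ T, 0 < meanVorticity u x L r := fun r hr =>
    mul_pos (one_div_pos.2 (hx.length_pos r hr)) (segMass_pos hu hT₀ hx hr)
  have hd : ∀ r ∈ Ioo T₀ t, ∃ Q', HasDerivAt (meanVorticity u x L) Q' r ∧
      Q' ≤ growthRate C₀ Cl u x L r * meanVorticity u x L r := fun r hr => by
    have hr' := hsub (Ioo_subset_Icc_self hr)
    exact exists_hasDerivAt_meanVorticity hu hT₀ hx hL hCl ⟨hr.1, hr'.2⟩ (hend r hr')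
      (hkappa r hr') (htau r hr') (hfoot r hr')
  choose! Q' hQ' hQle using hd
  obtain ⟨hLc, hJc⟩ := hc.continuousOn_length_mass hu hT₀ hx ht.1 ht.2
  have hQc : ContinuousOn (meanVorticity u x L) (Icc T₀ t) :=
    (continuousOn_const.div hLc fun r hr => (hx.length_pos r (hsub hr)).ne').mul hJc
  -- This form of the comparison needs only an integrable upper bound for the derivative of log Q;
  -- continuity of the rate is not available.
  have hlog := intervalIntegral.sub_le_integral_of_hasDeriv_right_of_le ht.1
    (g := fun r => Real.log (meanVorticity u x L r))
    (g' := fun r => Q' r / meanVorticity u x L r) (φ := growthRate C₀ Cl u x L)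
    (hQc.log fun r hr => (hpos r (hsub hr)).ne')
    (fun r hr => ((hQ' r hr).log (hpos r (hsub (Ioo_subset_Icc_self hr))).ne').hasDerivWithinAt)
    (hc.integrableOn_growthRate hu hT₀ hx C₀ Cl ht.1 ht.2)
    (fun r hr => (div_le_iff₀ (hpos r (hsub (Ioo_subset_Icc_self hr)))).2 (hQle r hr))
  have h0 := hpos T₀ ⟨le_rfl, ht.1.trans_lt ht.2⟩
  rw [← Real.exp_log (hpos t ht), ← Real.exp_log h0, ← Real.exp_add, Real.exp_le_exp]
  linarith

end


end VortexGrowth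

end

/-! ### Conclusion -/

theorem mainTheorem1 (T T₀ : ℝ) (hT₀ : 0 ≤ T₀) (hT : T₀ < T)
    (u : ℝ → VortexGrowth.E3 → VortexGrowth.E3) (p : ℝ → VortexGrowth.E3 → ℝ)
    (hu : VortexGrowth.IsEulerSolution T u p)
    (x : ℝ → ℝ → VortexGrowth.E3) (L : ℝ → ℝ)
    (hx : VortexGrowth.IsVortexSegmentFamily u T₀ T x L)
    (hL : AntitoneOn L (Set.Ico T₀ T))
    (c₀ : ℝ) (hc₀ : 0 < c₀) (hc₀' : c₀ ≤ 1)
    (hcomp : ∀ t ∈ Set.Ico T₀ T, ENNReal.ofReal c₀ * VortexGrowth.maxVorticity u t ≤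
      ENNReal.ofReal (VortexGrowth.segMaxVorticity u x L t))
    (hend : ∀ t ∈ Set.Ico T₀ T, ‖VortexGrowth.curl (u t) (x (L t) t)‖ =
      VortexGrowth.segMaxVorticity u x L t)
    (C₀ Cl : ℝ) (hC₀ : 0 < C₀) (hCl : 0 < Cl)
    (hkappa : ∀ t ∈ Set.Ico T₀ T,
      ∫ s in (0 : ℝ)..(L t), |VortexGrowth.kappa (u t) (x s t)| ≤ C₀)
    (htau : ∀ t ∈ Set.Ico T₀ T,
      ∫ s in (0 : ℝ)..(L t), |VortexGrowth.tau (u t) (x s t)| ≤ C₀)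
    (hfoot : ∀ t ∈ Set.Ico T₀ T, ∃ x₀' : VortexGrowth.E3,
      HasDerivWithinAt (fun r => x 0 r) x₀' (Set.Ico T₀ T) t ∧
      |inner ℝ x₀' (VortexGrowth.xi (u t) (x 0 t))| ≤
        Cl * VortexGrowth.tangentialSpeed u x L t) :
    ∀ t ∈ Set.Ico T₀ T,
      IntervalIntegrable (VortexGrowth.growthRate C₀ Cl u x L) MeasureTheory.volume T₀ t ∧
      VortexGrowth.maxVorticity u t ≤
        ENNReal.ofReal (VortexGrowth.meanVorticity u x L T₀ / c₀ *
          Real.exp (C₀ + ∫ r in T₀..t, VortexGrowth.growthRate C₀ Cl u x L r)) := by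
  intro t ht
  obtain ⟨I, y, β₁, β₂, s, hc⟩ := hx.exists_coordinate
  refine ⟨?_, ?_⟩
  · rw [intervalIntegrable_iff_integrableOn_Icc_of_le ht.1]
    exact hc.integrableOn_growthRate hu hT₀ hx C₀ Cl ht.1 ht.2
  have hmean := VortexGrowth.meanVorticity_le hu hT₀ hx hL hCl.le hend hkappa htau hfoot ht
  have hmax := VortexGrowth.segMaxVorticity_le hu hT₀ hx ht (hend t ht) (htau t ht)
  set E := ∫ r in T₀..t, VortexGrowth.growthRate C₀ Cl u x L r
  have hle : VortexGrowth.segMaxVorticity u x L t / c₀ ≤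
      VortexGrowth.meanVorticity u x L T₀ / c₀ * Real.exp (C₀ + E) := by
    rw [div_mul_eq_mul_div, Real.exp_add]
    gcongr
    calc VortexGrowth.segMaxVorticity u x L t
        ≤ Real.exp C₀ * (VortexGrowth.meanVorticity u x L T₀ * Real.exp E) :=
          hmax.trans (mul_le_mul_of_nonneg_left hmean (Real.exp_pos _).le)
      _ = _ := by ring
  -- Dividing by the positive finite c₀ in [0, ∞] also shows that Ω(t) is finite; this is not
  -- assumed beforehand.
  refine le_trans ?_ (ENNReal.ofReal_le_ofReal hle)
  rw [ENNReal.ofReal_div_of_pos hc₀, ENNReal.le_div_iff_mul_le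
    (Or.inl (ENNReal.ofReal_pos.2 hc₀).ne') (Or.inl ENNReal.ofReal_ne_top), mul_comm]
  exact hcomp t ht
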